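/- **Theorem (Pool Adjacent Violators is an omnipredictor).** A loss $\ell:[0,1]\times\{0,1\}\to\mathbb R$ is *proper* if $\mathbb E_{y\sim\mathrm{Ber}(q)}[\ell(p,y)-\ell(q,y)]\ge 0$ for all $p,q\in[0,1]$; $\mathcal L^*$ is the set of proper losses with $|\ell(p,1)-\ell(p,0)|\le 1$ for all $p$; $\mathcal M_+$ is the set of nondecreasing functions $[0,1]\to[0,1]$. A measurable $\hat\kappa:[0,1]\to[0,1]$ is an *$(\varepsilon,\mathcal M_+)$-omnipredictor* for a distribution $J$ on $[0,1]\times\{0,1\}$ if $\mathbb E_J[\ell(\hat\kappa(p),y)]\le \mathbb E_J[\ell(\kappa(p),y)]+\varepsilon$ for all $\ell\in\mathcal L^*$ and $\kappa\in\mathcal M_+$. *Pool Adjacent Violators (PAV)*, on a finite sample $S$ of $m$ pairs $(p,y)\in[0,1]\times\{0,1\}$ (repetitions allowed), sorts $S$ by $p$ and starts from the sequence of one-point intervals $\{p\}$, one for each distinct value of $p$ in $S$. As long as there are adjacent intervals $I_j,I_{j+1}$ (in this order from left to right) with $\bar y_{I_j}\ge\bar y_{I_{j+1}}$, where $\bar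 y_I$ is the average of $y$ over the sample members with $p\in I$, it replaces some such pair by the interval which the two span. Its post-processing $\hat\kappa_S$ takes the value $\bar y_{I}$ at every sample point in a final interval $I$, is interpolated linearly between neighbouring sample points, and is constant to the left of the smallest and to the right of the largest one (for $m=0$, it is the identity). 1. For every finite sample $S$ and every choice of the pairs that are pooled, $\hat\kappa_S\in\mathcal M_+$, and for every proper loss $\ell$ (bounded or not) $$\sum_{(p,y)\in S}\ell(\hat\kappa_S(p),y)=\min_{\kappa\in\mathcal M_+}\sum_{(p,y)\in S}\ell(\kappa(p),y).$$ 2. PAV, implemented by merge sort and a stack of intervals with their sums and counts, computes the sorted sample, the final intervals and their averages in $O(m\log m)$ steps for every sample of size $m\ge 2$ (unit cost for real arithmetic, comparisons and list operations). 3. There are absolute constants $C,C',r$ such that for all $\varepsilon,\delta\in(0,1)$: for every $m\ge C\log(2/(\varepsilon\delta))/\varepsilon^2$ and every distribution $J$ on $[0,1]\times\{0,1\}$, if $S$ consists of $m$ i.i.d. samples from $J$, then with probability at least $1-\delta$ the function $\hat\kappa_S$ is an $(\varepsilon,\mathcal M_+)$-omnipredictor for $J$; and on every sample of size $m=\lceil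 C\log(2/(\varepsilon\delta))/\varepsilon^2\rceil$ the implementation of part 2 takes at most $C'\log^r(2/(\varepsilon\delta))/\varepsilon^2$ steps, i.e. $\tilde O(1/\varepsilon^2)$. -/

import Mathlib

noncomputable section

namespace PAV

/-! ### Losses, post-processings and omniprediction -/

/-- A prediction-outcome pair `(p, y)` with `p ∈ [0,1]` and `y ∈ {0,1}`. -/
abbrev Sample : Type := unitInterval × Bool

/-- The outcome as a number: `true` is `1` and `false` is `0`. -/
def label (y : Bool) : ℕ := if y then 1 else 0

/-- The expectation of `f y` for `y` Bernoulli with parameter `q`. -/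
def bernoulliExp (q : unitInterval) (f : Bool → ℝ) : ℝ :=
  (q : ℝ) * f true + (1 - (q : ℝ)) * f false

/-- A loss is proper if truthful prediction minimizes the expected loss. -/
def IsProper (l : unitInterval → Bool → ℝ) : Prop :=
  ∀ p q : unitInterval, 0 ≤ bernoulliExp q (fun y => l p y - l q y)

/-- The class `L*` of proper losses with `|l(p,1) - l(p,0)| ≤ 1` for all `p`. -/
def LStar : Set (unitInterval → Bool → ℝ) :=
  {l | IsProper l ∧ ∀ p, |l p true - l p false| ≤ 1}

/-- The class `M₊` of nondecreasing post-processings. -/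
def MPlus : Set (unitInterval → unitInterval) := {k | Monotone k}

/-- `khat` is an `(ε, K)`-omnipredictor for `J`. The losses in `LStar` are bounded and monotone in the
prediction, so for measurable post-processings (such as monotone ones) all the integrals exist. -/
def IsOmnipredictor (ε : ℝ) (K : Set (unitInterval → unitInterval))
    (J : MeasureTheory.Measure Sample) (khat : unitInterval → unitInterval) : Prop :=
  Measurable khat ∧ ∀ l ∈ LStar, ∀ k ∈ K,
    ∫ z, l (khat z.1) z.2 ∂J ≤ (∫ z, l (k z.1) z.2 ∂J) + ε

/-- The total loss of the post-processing `k` on the finite sample `S`. -/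
def empiricalLoss (l : unitInterval → Bool → ℝ) (S : List Sample)
    (k : unitInterval → unitInterval) : ℝ :=
  (S.map fun z => l (k z.1) z.2).sum

/-! ### Pool Adjacent Violators

The pair `A = (a, b)` stands for the interval `[a, b]`. -/

/-- The members of the sample whose prediction lies in the interval `A`. -/
def inInterval (O : List Sample) (A : unitInterval × unitInterval) : List Sample :=
  O.filter fun z => decide (A.1 ≤ z.1 ∧ z.1 ≤ A.2)

/-- The average outcome over the members of the sample in the interval `A`. -/
def intervalMean (O : List Sample) (A : unitInterval × unitInterval) : ℝ :=
  (((inInterval O A).map fun z => label z.2).sum : ℝ) / ((inInterval O A).length : ℝ)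

/-- The initial intervals `{p}`, one for each distinct prediction `p`, in the order of `O`. -/
def initialIntervals (O : List Sample) : List (unitInterval × unitInterval) :=
  (O.map Prod.fst).dedup.map fun p => (p, p)

/-- One iteration of the loop: two adjacent intervals `A`, `B`, whose averages satisfy
`mean A ≥ mean B`, are replaced by the interval that they span. Any such pair may be chosen. -/
def PoolStep (O : List Sample) (s t : List (unitInterval × unitInterval)) : Prop :=
  ∃ L A B R, s = L ++ A :: B :: R ∧ intervalMean O B ≤ intervalMean O A ∧
    t = L ++ (A.1, B.2) :: R

/-- `(O, T)` is a possible output of Pool Adjacent Violators on `S`: `O` is an ordering of `S` by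
the predictions, and `T` is reached from the initial intervals by pooling steps, in some order,
until no step is possible. -/
def IsPAVOutput (S O : List Sample) (T : List (unitInterval × unitInterval)) : Prop :=
  O.Perm S ∧ O.Pairwise (fun z w => z.1 ≤ w.1) ∧
    Relation.ReflTransGen (PoolStep O) (initialIntervals O) T ∧ ¬ ∃ t, PoolStep O T t

/-- The value at a sample point `q`: the average outcome on the interval of `T` containing `q`. -/
def fittedValue (O : List Sample) (T : List (unitInterval × unitInterval)) (q : unitInterval) :
    ℝ :=
  match T.find? (fun A => decide (A.1 ≤ q ∧ q ≤ A.2)) with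
  | some A => intervalMean O A
  | none => 0

/-- The fitted values, interpolated linearly between neighbouring sample points and extended by
constants beyond the extreme ones (and `x` itself, if there is no sample point at all). If `O` is
sorted, then `a` below is the largest sample point `≤ x` and `b` is the smallest one `≥ x`; for
`a = b = x` the second summand vanishes. -/
def interpolation (O : List Sample) (T : List (unitInterval × unitInterval)) (x : unitInterval) :
    ℝ :=
  match ((O.map Prod.fst).filter fun q => decide (q ≤ x)).getLast?,
      ((O.map Prod.fst).filter fun q => decide (x ≤ q)).head? with
  | some a, some b =>
      fittedValue O T a +
        ((x : ℝ) - (a : ℝ)) / ((b : ℝ) - (a : ℝ)) * (fittedValue O T b - fittedValue O T a)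
  | some a, none => fittedValue O T a
  | none, some b => fittedValue O T b
  | none, none => (x : ℝ)

theorem intervalMean_mem (O : List Sample) (A : unitInterval × unitInterval) :
    intervalMean O A ∈ Set.Icc (0 : ℝ) 1 := by
  have key : ∀ L : List Sample, (L.map fun z => label z.2).sum ≤ L.length := by
    intro L
    induction L with
    | nil => simp
    | cons z L ih =>
      have hz : label z.2 ≤ 1 := by unfold label; split <;> simp
      simp only [List.map_cons, List.sum_cons, List.length_cons]
      omega
  unfold intervalMean
  have h := key (inInterval O A)
  constructor
  · positivity
  · exact div_le_one_of_le₀ (by exact_mod_cast h) (by positivity)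

theorem fittedValue_mem (O : List Sample) (T : List (unitInterval × unitInterval))
    (q : unitInterval) : fittedValue O T q ∈ Set.Icc (0 : ℝ) 1 := by
  unfold fittedValue
  split
  · exact intervalMean_mem O _
  · simp

theorem interpolation_mem (O : List Sample) (T : List (unitInterval × unitInterval))
    (x : unitInterval) : interpolation O T x ∈ Set.Icc (0 : ℝ) 1 := by
  unfold interpolation
  split
  · rename_i a b ha hb
    have h1 : a ≤ x := by
      have := List.mem_of_getLast? ha
      simpa using (List.mem_filter.mp this).2
    have h2 : x ≤ b := by
      have := List.mem_of_head? hb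
      simpa using (List.mem_filter.mp this).2
    have h1r : (a : ℝ) ≤ x := h1
    have h2r : (x : ℝ) ≤ b := h2
    have ht0 : 0 ≤ ((x : ℝ) - (a : ℝ)) / ((b : ℝ) - (a : ℝ)) :=
      div_nonneg (by linarith) (by linarith)
    have ht1 : ((x : ℝ) - (a : ℝ)) / ((b : ℝ) - (a : ℝ)) ≤ 1 :=
      div_le_one_of_le₀ (by linarith) (by linarith)
    obtain ⟨u0, u1⟩ := fittedValue_mem O T a
    obtain ⟨v0, v1⟩ := fittedValue_mem O T b
    constructor <;> nlinarith
  · exact fittedValue_mem O T _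
  · exact fittedValue_mem O T _
  · exact x.2

/-- The post-processing that belongs to the output `(O, T)`. -/
def postProcessing (O : List Sample) (T : List (unitInterval × unitInterval)) :
    unitInterval → unitInterval :=
  fun x => ⟨interpolation O T x, interpolation_mem O T x⟩

/-! ### A step-counted implementation

Unit-cost real random access machine: every function call (with its case distinction on a list),
every creation of a list cell, every comparison and every arithmetic operation takes one step. -/

/-- The result of a computation together with the number of steps it took. -/
structure Timed (α : Type) where
  val : α
  time : ℕ

instance : Monad Timed where
  pure a := ⟨a, 0⟩
  bind x f := ⟨(f x.val).val, x.time + (f x.val).time⟩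

/-- A single step without a result. -/
def tick : Timed Unit := ⟨(), 1⟩

/-- Creation of a list cell. -/
def consT {α : Type} (a : α) (l : List α) : Timed (List α) := ⟨a :: l, 1⟩

/-- Comparison of real numbers. -/
def leT (x y : ℝ) : Timed Bool := ⟨decide (x ≤ y), 1⟩

/-- Equality test of real numbers. -/
def eqT (x y : ℝ) : Timed Bool := ⟨decide (x = y), 1⟩

/-- Addition of integers. -/
def addT (x y : ℕ) : Timed ℕ := ⟨x + y, 1⟩

/-- Division. -/
def divT (x y : ℕ) : Timed ℝ := ⟨(x : ℝ) / (y : ℝ), 1⟩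

/-- Length of a list, by traversal. -/
def lengthT {α : Type} : List α → Timed ℕ
  | [] => do tick; return 0
  | _ :: l => do
      tick
      let n ← lengthT l
      addT n 1

/-- Reversal of a list onto an accumulator. -/
def reverseT {α : Type} : List α → List α → Timed (List α)
  | [], acc => do tick; return acc
  | a :: l, acc => do
      tick
      let acc' ← consT a acc
      reverseT l acc'

/-- Merging of two sorted lists. -/
def mergeT : List Sample → List Sample → Timed (List Sample)
  | [], ys => do tick; return ys
  | x :: xs, [] => do tick; return x :: xs
  | x :: xs, y :: ys => do
      tick
      let c ← leT x.1 y.1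
      if c then
        let r ← mergeT xs (y :: ys)
        consT x r
      else
        let r ← mergeT (x :: xs) ys
        consT y r
termination_by xs ys => xs.length + ys.length

/-- Merge sort of the first `n` entries; also returns the remaining entries. The three steps at the
start of the recursive case are the call, the halving and the subtraction. -/
def sortT : ℕ → List Sample → Timed (List Sample × List Sample)
  | 0, l => do tick; return ([], l)
  | 1, [] => do tick; return ([], [])
  | 1, x :: l => do
      tick
      let s ← consT x []
      return (s, l)
  | n + 2, l => do
      tick
      tick
      tick
      let u ← sortT ((n + 2) / 2) l
      let v ← sortT ((n + 2) - (n + 2) / 2) u.2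
      let s ← mergeT u.1 v.1
      return (s, v.2)
termination_by n => n

/-- An interval `[lo, hi]` with the sum of the outcomes on it and the number of its samples. -/
structure Block where
  lo : unitInterval
  hi : unitInterval
  sum : ℕ
  cnt : ℕ

/-- The interval of a block. -/
def Block.interval (b : Block) : unitInterval × unitInterval := (b.lo, b.hi)

/-- The average recorded in a block. -/
def Block.mean (b : Block) : ℝ := (b.sum : ℝ) / (b.cnt : ℝ)

/-- Formation of the initial blocks from a sorted sample; `b` is the block of the prediction that
was read last. -/
def groupAuxT (b : Block) : List Sample → Timed (List Block)
  | [] => do tick; consT b []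
  | z :: zs => do
      tick
      let c ← eqT b.hi z.1
      if c then
        let s ← addT b.sum (label z.2)
        let n ← addT b.cnt 1
        groupAuxT ⟨b.lo, b.hi, s, n⟩ zs
      else
        let r ← groupAuxT ⟨z.1, z.1, label z.2, 1⟩ zs
        consT b r

/-- The initial blocks of a sorted sample. -/
def groupT : List Sample → Timed (List Block)
  | [] => do tick; return []
  | z :: zs => do tick; groupAuxT ⟨z.1, z.1, label z.2, 1⟩ zs

/-- Placement of the block `b` on the stack `st` (rightmost block on top): as long as the top of the
stack violates monotonicity with `b`, it is removed and pooled with `b`. -/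
def pushT (b : Block) : List Block → Timed (List Block)
  | [] => do tick; consT b []
  | a :: st => do
      tick
      let x ← divT a.sum a.cnt
      let y ← divT b.sum b.cnt
      let c ← leT y x
      if c then
        let s ← addT a.sum b.sum
        let n ← addT a.cnt b.cnt
        pushT ⟨a.lo, b.hi, s, n⟩ st
      else
        consT b (a :: st)

/-- Placement of all blocks on the stack, from left to right. -/
def poolT : List Block → List Block → Timed (List Block)
  | st, [] => do tick; return st
  | st, b :: bs => do
      tick
      let st' ← pushT b st
      poolT st' bs

/-- Pool Adjacent Violators: returns the sorted sample and the final blocks. -/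
def pavT (S : List Sample) : Timed (List Sample × List Block) := do
  tick
  let n ← lengthT S
  let o ← sortT n S
  let bs ← groupT o.1
  let st ← poolT [] bs
  let T ← reverseT st []
  return (o.1, T)

end PAV

end

noncomputable section
namespace PAV

/-! ### Sums over intervals -/

/-! For a proper loss l put D(p) = l(p,1) - l(p,0). Adding the propriety inequalities for (p,q) and
(q,p) shows that D is nonincreasing (`IsProper.antitone_sub`). On a block with mean a, replacing the
constant prediction a by a monotone k changes the loss at (p,y) by the Ber(a)-expected change, which
is nonnegative, plus (y - a)(D(k p) - D(a)). The D(a) terms sum to zero, so the constant a is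
optimal on the block as soon as the residuals y - a correlate nonnegatively with every nonincreasing
function of p. This property, `IsCalibrated`, does not mention the loss. It holds for one-point
blocks and survives the pooling of a violating pair (`IsCalibrated.pool`), whatever the order of
pooling. Summing over the final blocks gives optimality for all proper losses at once; and since no
violating pair is left, the block means increase strictly and the interpolation is monotone.

The implementation is correct because its stack operations are one particular run of the
nondeterministic pooling relation (`pushT_spec`, `poolT_spec`). Pooling takes linear time by
amortization against the stack height (`pushT_time`), so sorting dominates.

For the distributional claim, a loss in `LStar` composed with a monotone post-processing is, on each
outcome separately, monotone in p with range at most 2. By the layer-cake formula its expectation is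
controlled by the masses of upper sets (`abs_integral_loss_sub_le`). Hence a single event, uniform
convergence over upper sets for both outcomes, serves all losses, all competitors and the
data-dependent fit itself. Its probability is bounded by bracketing upper sets between finitely many
quantile rays (`exists_brackets`), Hoeffding's inequality and a union bound. -/

theorem sum_map_nonneg {α : Type} {X : List α} {f : α → ℝ} (h : ∀ z ∈ X, 0 ≤ f z) :
    0 ≤ (X.map f).sum := by
  apply List.sum_nonneg
  simpa using h

theorem sum_map_filter_add {α : Type} (X : List α) (p : α → Bool) (f : α → ℝ) :
    ((X.filter p).map f).sum + ((X.filter fun z => !p z).map f).sum = (X.map f).sum := by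
  rw [← List.sum_append, ← List.map_append]
  exact ((List.filter_append_perm p X).map f).sum_eq

theorem rel_or_rel_of_pairwise {α : Type} {R : α → α → Prop} {X : List α} (h : X.Pairwise R)
    {a b : α} (ha : a ∈ X) (hb : b ∈ X) (hab : a ≠ b) : R a b ∨ R b a := by
  have : Std.Symm fun a b => R a b ∨ R b a := ⟨fun _ _ h => h.symm⟩
  exact (h.imp (S := fun a b => R a b ∨ R b a) Or.inl).forall ha hb hab

/-- `T` is a list of intervals, ordered from left to right, that partitions the sample `O` into
nonempty parts. -/
structure IsPartition (O : List Sample) (T : List (unitInterval × unitInterval)) : Prop where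
  le : ∀ A ∈ T, A.1 ≤ A.2
  nonempty : ∀ A ∈ T, inInterval O A ≠ []
  sep : T.Pairwise fun A B => A.2 < B.1
  cover : ∀ z ∈ O, ∃ A ∈ T, A.1 ≤ z.1 ∧ z.1 ≤ A.2

theorem mem_inInterval {O : List Sample} {A : unitInterval × unitInterval} {z : Sample} :
    z ∈ inInterval O A ↔ z ∈ O ∧ A.1 ≤ z.1 ∧ z.1 ≤ A.2 := by
  simp [inInterval]

/-- The spanned interval also contains the gap between A and B, so the gap must be free of sample
points. For neighbours in a partition, `IsPartition.adjacent` provides this. -/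
theorem inInterval_pool_perm {O : List Sample} {A B : unitInterval × unitInterval}
    (hA : A.1 ≤ A.2) (hAB : A.2 < B.1) (hB : B.1 ≤ B.2)
    (h : ∀ z ∈ O, A.1 ≤ z.1 → z.1 ≤ B.2 → z.1 ≤ A.2 ∨ B.1 ≤ z.1) :
    (inInterval O (A.1, B.2)).Perm (inInterval O A ++ inInterval O B) := by
  refine (List.filter_append_perm (fun z => decide (A.1 ≤ z.1 ∧ z.1 ≤ A.2))
    (inInterval O (A.1, B.2))).symm.trans (List.Perm.of_eq ?_)
  congr 1
  · unfold inInterval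
    rw [List.filter_filter]
    refine List.filter_congr fun z _ => ?_
    have : z.1 ≤ A.2 → z.1 ≤ B.2 := fun h => h.trans (hAB.le.trans hB)
    simp only [Bool.decide_and]
    grind
  · unfold inInterval
    rw [List.filter_filter]
    refine List.filter_congr fun z hz => ?_
    have h1 := h z hz
    have h2 : B.1 ≤ z.1 → A.2 < z.1 := fun h => hAB.trans_le h
    have h3 : A.2 < z.1 → A.1 ≤ z.1 := fun h => hA.trans h.le
    have h4 : A.2 < z.1 ↔ ¬ z.1 ≤ A.2 := not_le.symm
    simp only [Bool.decide_and]
    grind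

theorem IsPartition.adjacent {O : List Sample} {L R : List (unitInterval × unitInterval)}
    {A B : unitInterval × unitInterval} (h : IsPartition O (L ++ A :: B :: R)) {z : Sample}
    (hz : z ∈ O) (h1 : A.1 ≤ z.1) (h2 : z.1 ≤ B.2) : z.1 ≤ A.2 ∨ B.1 ≤ z.1 := by
  obtain ⟨D, hD, hD1, hD2⟩ := h.cover z hz
  have hs := h.sep
  simp only [List.pairwise_append, List.pairwise_cons, List.mem_cons, List.mem_append] at hs hD
  rcases hD with hD | rfl | rfl | hD
  · exact absurd (hs.2.2 D hD A (Or.inl rfl)) (not_lt.2 (h1.trans hD2))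
  · exact Or.inl hD2
  · exact Or.inr hD1
  · exact absurd (hs.2.1.2.1 D hD) (not_lt.2 (hD1.trans h2))

theorem IsPartition.pool_perm {O : List Sample} {L R : List (unitInterval × unitInterval)}
    {A B : unitInterval × unitInterval} (h : IsPartition O (L ++ A :: B :: R)) :
    (inInterval O (A.1, B.2)).Perm (inInterval O A ++ inInterval O B) := by
  have hs := h.sep
  simp only [List.pairwise_append, List.pairwise_cons, List.mem_cons] at hs
  exact inInterval_pool_perm (h.le A (by simp)) (hs.2.1.1 B (Or.inl rfl)) (h.le B (by simp))
    fun z hz h1 h2 => h.adjacent hz h1 h2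

theorem IsPartition.pool {O : List Sample} {L R : List (unitInterval × unitInterval)}
    {A B : unitInterval × unitInterval} (h : IsPartition O (L ++ A :: B :: R)) :
    IsPartition O (L ++ (A.1, B.2) :: R) := by
  have hs := h.sep
  have hA := h.le A (by simp)
  have hB := h.le B (by simp)
  simp only [List.pairwise_append, List.pairwise_cons, List.mem_cons] at hs
  have hAB := hs.2.1.1 B (Or.inl rfl)
  refine ⟨?_, ?_, ?_, ?_⟩
  · intro D hD
    simp only [List.mem_append, List.mem_cons] at hD
    rcases hD with hD | rfl | hD
    · exact h.le D (by simp [hD])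
    · exact hA.trans (hAB.le.trans hB)
    · exact h.le D (by simp [hD])
  · intro D hD
    simp only [List.mem_append, List.mem_cons] at hD
    rcases hD with hD | rfl | hD
    · exact h.nonempty D (by simp [hD])
    · intro h0
      have := h.pool_perm
      rw [h0] at this
      exact h.nonempty A (by simp) (List.append_eq_nil_iff.1 this.nil_eq.symm).1
    · exact h.nonempty D (by simp [hD])
  · simp only [List.pairwise_append, List.pairwise_cons, List.mem_cons]
    refine ⟨hs.1, ⟨hs.2.1.2.1, hs.2.1.2.2⟩, ?_⟩
    rintro D hD E (rfl | hE)
    · exact hs.2.2 D hD A (Or.inl rfl)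
    · exact hs.2.2 D hD E (Or.inr (Or.inr hE))
  · intro z hz
    obtain ⟨D, hD, hD1, hD2⟩ := h.cover z hz
    simp only [List.mem_append, List.mem_cons] at hD
    rcases hD with hD | rfl | rfl | hD
    · exact ⟨D, by simp [hD], hD1, hD2⟩
    · exact ⟨(D.1, B.2), by simp, hD1, hD2.trans (hAB.le.trans hB)⟩
    · exact ⟨(A.1, D.2), by simp, hA.trans (hAB.le.trans hD1), hD2⟩
    · exact ⟨D, by simp [hD], hD1, hD2⟩

theorem isPartition_initialIntervals {O : List Sample}
    (hO : O.Pairwise fun z w => z.1 ≤ w.1) : IsPartition O (initialIntervals O) := by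
  refine ⟨?_, ?_, ?_, ?_⟩
  · simp only [initialIntervals, List.mem_map]
    rintro _ ⟨p, -, rfl⟩
    exact le_rfl
  · simp only [initialIntervals, List.mem_map, List.mem_dedup]
    rintro _ ⟨p, ⟨z, hz, rfl⟩, rfl⟩ h0
    have : z ∈ inInterval O (z.1, z.1) := mem_inInterval.2 ⟨hz, le_rfl, le_rfl⟩
    simp [h0] at this
  · unfold initialIntervals
    rw [List.pairwise_map]
    have h1 : (O.map Prod.fst).Pairwise (· ≤ ·) := List.pairwise_map.2 hO
    have h2 := h1.sublist (List.dedup_sublist _)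
    exact (h2.and (List.nodup_dedup (O.map Prod.fst))).imp fun h => lt_of_le_of_ne h.1 h.2
  · intro z hz
    refine ⟨(z.1, z.1), ?_, le_rfl, le_rfl⟩
    simp only [initialIntervals, List.mem_map, List.mem_dedup]
    exact ⟨z.1, ⟨z, hz, rfl⟩, rfl⟩

/-- Induction on T: the head interval removes its own samples, and the later intervals, lying to its
right, see the same samples in the remainder. The sample therefore has to vary in the induction. -/
theorem sum_eq_sum_intervals {T : List (unitInterval × unitInterval)}
    (hT : T.Pairwise fun A B => A.2 < B.1) (f : Sample → ℝ) :
    ∀ O : List Sample, (∀ z ∈ O, ∃ A ∈ T, A.1 ≤ z.1 ∧ z.1 ≤ A.2) →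
      (O.map f).sum = (T.map fun A => ((inInterval O A).map f).sum).sum := by
  induction T with
  | nil =>
    intro O hO
    cases O with
    | nil => simp
    | cons z O => simpa using hO z
  | cons A T ih =>
    intro O hO
    rw [List.pairwise_cons] at hT
    have ih' := ih hT.2 (O.filter fun z => !decide (A.1 ≤ z.1 ∧ z.1 ≤ A.2)) (by
      intro z hz
      simp only [List.mem_filter, Bool.not_eq_true', decide_eq_false_iff_not] at hz
      obtain ⟨B, hB, h⟩ := hO z hz.1
      rcases List.mem_cons.1 hB with rfl | hB
      · exact absurd h hz.2
      · exact ⟨B, hB, h⟩)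
    rw [← sum_map_filter_add O (fun z => decide (A.1 ≤ z.1 ∧ z.1 ≤ A.2)) f, List.map_cons,
      List.sum_cons, ih']
    congr 1
    refine congrArg List.sum (List.map_congr_left fun B hB => ?_)
    refine congrArg (fun X => (List.map f X).sum) ?_
    unfold inInterval
    rw [List.filter_filter]
    refine List.filter_congr fun z _ => ?_
    have h1 : B.1 ≤ z.1 → ¬ z.1 ≤ A.2 := fun h => not_le.2 ((hT.1 B hB).trans_le h)
    simp only [Bool.decide_and]
    grind

theorem sum_label_eq {O : List Sample} {A : unitInterval × unitInterval}
    (h : inInterval O A ≠ []) :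
    ((inInterval O A).map fun z => (label z.2 : ℝ)).sum
      = intervalMean O A * (inInterval O A).length := by
  have : ((inInterval O A).length : ℝ) ≠ 0 := by
    simpa [List.length_eq_zero_iff] using h
  unfold intervalMean
  rw [div_mul_cancel₀ _ this]
  induction inInterval O A with
  | nil => simp
  | cons z X ih => simp [ih]

/-! ### Optimality of pooled blocks -/

/-- The residuals on the interval `A` correlate nonnegatively with every nonincreasing function. -/
def IsCalibrated (O : List Sample) (A : unitInterval × unitInterval) : Prop :=
  ∀ h : unitInterval → ℝ, Antitone h →
    0 ≤ ((inInterval O A).map fun z => ((label z.2 : ℝ) - intervalMean O A) * h z.1).sum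

theorem sum_residual_shift (X : List Sample) (h : unitInterval → ℝ) (a M : ℝ) :
    (X.map fun z => ((label z.2 : ℝ) - M) * h z.1).sum
      = (X.map fun z => ((label z.2 : ℝ) - a) * h z.1).sum
        + (a - M) * (X.map fun z => h z.1).sum := by
  induction X with
  | nil => simp
  | cons z X ih => simp only [List.map_cons, List.sum_cons, ih]; ring

theorem sum_residual (X : List Sample) (M : ℝ) :
    (X.map fun z => ((label z.2 : ℝ) - M)).sum
      = (X.map fun z => (label z.2 : ℝ)).sum - M * X.length := by
  induction X with
  | nil => simp
  | cons z X ih =>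
    simp only [List.map_cons, List.sum_cons, ih, List.length_cons, Nat.cast_succ]; ring

theorem isCalibrated_singleton {O : List Sample} {p : unitInterval}
    (h0 : inInterval O (p, p) ≠ []) : IsCalibrated O (p, p) := by
  intro h _
  have : (inInterval O (p, p)).map (fun z => ((label z.2 : ℝ) - intervalMean O (p, p)) * h z.1)
      = (inInterval O (p, p)).map
        (fun z => ((label z.2 : ℝ) - intervalMean O (p, p)) * h p) := by
    refine List.map_congr_left fun z hz => ?_
    have := mem_inInterval.1 hz
    rw [le_antisymm this.2.2 this.2.1]
  rw [this, List.sum_map_mul_right, sum_residual, sum_label_eq h0]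
  simp

/-- The pooled mean M lies between the means b ≤ a. Passing to residuals about M adds (a - M) times
the sum of h over A and subtracts (M - b) times the sum of h over B. As h is nonincreasing, it is at
least h(A.2) on A and at most h(A.2) on B; the weights (a - M)n and (M - b)k agree, so the added
contribution is nonnegative. -/
theorem IsCalibrated.pool {O : List Sample} {L R : List (unitInterval × unitInterval)}
    {A B : unitInterval × unitInterval} (hP : IsPartition O (L ++ A :: B :: R))
    (hA : IsCalibrated O A) (hB : IsCalibrated O B)
    (hAB : intervalMean O B ≤ intervalMean O A) : IsCalibrated O (A.1, B.2) := by
  intro h hh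
  have hperm := hP.pool_perm
  have hnA := hP.nonempty A (by simp)
  have hnB := hP.nonempty B (by simp)
  have hM := sum_label_eq (hP.pool.nonempty (A.1, B.2) (by simp))
  rw [(hperm.map _).sum_eq, hperm.length_eq, List.map_append, List.sum_append,
    List.length_append, sum_label_eq hnA, sum_label_eq hnB] at hM
  rw [(hperm.map _).sum_eq, List.map_append, List.sum_append]
  set M := intervalMean O (A.1, B.2)
  rw [sum_residual_shift _ h (intervalMean O A) M, sum_residual_shift _ h (intervalMean O B) M]
  have h1 := hA h hh
  have h2 := hB h hh
  have hsep : A.2 < B.1 := by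
    have hs := hP.sep
    simp only [List.pairwise_append, List.pairwise_cons, List.mem_cons] at hs
    exact hs.2.1.1 B (Or.inl rfl)
  have h3 : 0 ≤ ((inInterval O A).map fun z => h z.1 - h A.2).sum :=
    sum_map_nonneg fun z hz => sub_nonneg.2 (hh (mem_inInterval.1 hz).2.2)
  have h4 : 0 ≤ ((inInterval O B).map fun z => h A.2 - h z.1).sum :=
    sum_map_nonneg fun z hz =>
      sub_nonneg.2 (hh (hsep.le.trans (mem_inInterval.1 hz).2.1))
  have e3 : ∀ X : List Sample, (X.map fun z => h z.1 - h A.2).sum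
      = (X.map fun z => h z.1).sum - X.length * h A.2 := by
    intro X
    induction X with
    | nil => simp
    | cons z X ih =>
      simp only [List.map_cons, List.sum_cons, ih, List.length_cons, Nat.cast_succ]; ring
  have e4 : ∀ X : List Sample, (X.map fun z => h A.2 - h z.1).sum
      = X.length * h A.2 - (X.map fun z => h z.1).sum := by
    intro X
    induction X with
    | nil => simp
    | cons z X ih =>
      simp only [List.map_cons, List.sum_cons, ih, List.length_cons, Nat.cast_succ]; ring
  rw [e3] at h3
  rw [e4] at h4
  push_cast at hM
  have pA : (0 : ℝ) < (inInterval O A).length := by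
    exact_mod_cast List.length_pos_iff.2 hnA
  have pB : (0 : ℝ) < (inInterval O B).length := by
    exact_mod_cast List.length_pos_iff.2 hnB
  set a := intervalMean O A
  set b := intervalMean O B
  set n : ℝ := ((inInterval O A).length : ℝ)
  set k : ℝ := ((inInterval O B).length : ℝ)
  -- By `hM`, M is the average of a and b with weights n and k, so the violation b ≤ a gives b ≤ M ≤
  -- a.
  have ha : 0 ≤ a - M := by
    have : (a - M) * (n + k) = (a - b) * k := by linarith
    by_contra hc
    have : (a - M) * (n + k) < 0 := mul_neg_of_neg_of_pos (not_le.1 hc) (by linarith)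
    have : 0 ≤ (a - b) * k := mul_nonneg (by linarith) pB.le
    linarith
  have hb : 0 ≤ M - b := by
    have : (M - b) * (n + k) = (a - b) * n := by linarith
    by_contra hc
    have : (M - b) * (n + k) < 0 := mul_neg_of_neg_of_pos (not_le.1 hc) (by linarith)
    have : 0 ≤ (a - b) * n := mul_nonneg (by linarith) pA.le
    linarith
  have hw : (a - M) * n = (M - b) * k := by linarith
  have i1 := mul_nonneg ha h3
  have i2 := mul_nonneg hb h4
  have i3 : (a - M) * n * h A.2 = (M - b) * k * h A.2 := by rw [hw]
  nlinarith

theorem invariant_of_reachable {O : List Sample} (hO : O.Pairwise fun z w => z.1 ≤ w.1)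
    {T : List (unitInterval × unitInterval)}
    (h : Relation.ReflTransGen (PoolStep O) (initialIntervals O) T) :
    IsPartition O T ∧ ∀ A ∈ T, IsCalibrated O A := by
  induction h with
  | refl =>
    have hP := isPartition_initialIntervals hO
    refine ⟨hP, fun A hA => ?_⟩
    have hne := hP.nonempty A hA
    simp only [initialIntervals, List.mem_map] at hA
    obtain ⟨p, -, rfl⟩ := hA
    exact isCalibrated_singleton hne
  | tail _ hst ih =>
    obtain ⟨L, A, B, R, rfl, hm, rfl⟩ := hst
    refine ⟨ih.1.pool, fun D hD => ?_⟩
    simp only [List.mem_append, List.mem_cons] at hD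
    rcases hD with hD | rfl | hD
    · exact ih.2 D (by simp [hD])
    · exact (ih.2 A (by simp)).pool ih.1 (ih.2 B (by simp)) hm
    · exact ih.2 D (by simp [hD])

/-! ### Proper losses -/

theorem IsProper.antitone_sub {l : unitInterval → Bool → ℝ} (hl : IsProper l) :
    Antitone fun p => l p true - l p false := by
  intro p q hpq
  rcases hpq.eq_or_lt with rfl | hpq
  · exact le_rfl
  have h1 := hl p q
  have h2 := hl q p
  simp only [bernoulliExp] at h1 h2
  have : (p : ℝ) < q := hpq
  by_contra hc
  simp only [not_le] at hc
  nlinarith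

theorem IsProper.sum_le_of_isCalibrated {l : unitInterval → Bool → ℝ} (hl : IsProper l)
    {O : List Sample} {A : unitInterval × unitInterval} (hne : inInterval O A ≠ [])
    (hA : IsCalibrated O A) {k : unitInterval → unitInterval} (hk : Monotone k) :
    ((inInterval O A).map fun z => l ⟨intervalMean O A, intervalMean_mem O A⟩ z.2).sum
      ≤ ((inInterval O A).map fun z => l (k z.1) z.2).sum := by
  have h1 := hA (fun p => l (k p) true - l (k p) false) (hl.antitone_sub.comp_monotone hk)
  have h2 := sum_residual (inInterval O A) (intervalMean O A)
  rw [sum_label_eq hne, sub_self] at h2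
  have hprop : ∀ q : unitInterval, _ := fun q => hl q ⟨intervalMean O A, intervalMean_mem O A⟩
  simp only [bernoulliExp] at hprop
  generalize hMM : (⟨intervalMean O A, intervalMean_mem O A⟩ : unitInterval) = M' at *
  have hM' : intervalMean O A = (M' : ℝ) := by rw [← hMM]
  simp only [hM'] at h1 h2 hprop
  clear hM' hMM hA hne
  generalize inInterval O A = X at h1 h2 ⊢
  -- Termwise, the change of loss at outcome y is its Ber(M') expectation plus (y - M') times the
  -- change of l(·,1) - l(·,0); propriety with truth M' discards the expectation.
  have key : (X.map fun z => l M' z.2).sum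
      + (X.map fun z => ((label z.2 : ℝ) - M') * (l (k z.1) true - l (k z.1) false)).sum
      ≤ (X.map fun z => l (k z.1) z.2).sum
      + (X.map fun z => ((label z.2 : ℝ) - M')).sum * (l M' true - l M' false) := by
    clear h1 h2
    induction X with
    | nil => simp
    | cons z X ih =>
      simp only [List.map_cons, List.sum_cons]
      have := hprop (k z.1)
      rcases hz : z.2 <;> simp only [label] at * <;> simp at * <;> linarith
  rw [h2] at key
  linarith

/-! ### The interpolation -/

theorem IsPartition.fittedValue_eq {O : List Sample} {T : List (unitInterval × unitInterval)}
    (h : IsPartition O T) {A : unitInterval × unitInterval} (hA : A ∈ T) {q : unitInterval}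
    (h1 : A.1 ≤ q) (h2 : q ≤ A.2) : fittedValue O T q = intervalMean O A := by
  unfold fittedValue
  cases hf : T.find? (fun A => decide (A.1 ≤ q ∧ q ≤ A.2)) with
  | none =>
    rw [List.find?_eq_none] at hf
    simpa [h1, h2] using hf A hA
  | some B =>
    have hB := List.mem_of_find?_eq_some hf
    have hq := List.find?_some hf
    simp only [decide_eq_true_eq] at hq
    by_cases hBA : B = A
    · rw [hBA]
    have := rel_or_rel_of_pairwise h.sep hB hA hBA
    rcases this with h' | h'
    · exact absurd h' (not_lt.2 (h1.trans hq.2))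
    · exact absurd h' (not_lt.2 (hq.1.trans h2))

theorem pairwise_lt_of_not_poolStep {O : List Sample} {T : List (unitInterval × unitInterval)}
    (h : ¬ ∃ t, PoolStep O T t) :
    T.Pairwise fun A B => intervalMean O A < intervalMean O B := by
  have hc : T.IsChain fun A B => intervalMean O A < intervalMean O B := by
    rw [List.isChain_iff_forall_rel_of_append_cons_cons]
    intro A B L R hT
    by_contra hAB
    exact h ⟨_, L, A, B, R, hT, not_lt.1 hAB, rfl⟩
  have : IsTrans (unitInterval × unitInterval) fun A B => intervalMean O A < intervalMean O B :=
    ⟨fun _ _ _ => lt_trans⟩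
  exact hc.pairwise

theorem fittedValue_mono {O : List Sample} {T : List (unitInterval × unitInterval)}
    (h : IsPartition O T) (hT : ¬ ∃ t, PoolStep O T t) {p q : unitInterval}
    (hp : p ∈ O.map Prod.fst) (hq : q ∈ O.map Prod.fst) (hpq : p ≤ q) :
    fittedValue O T p ≤ fittedValue O T q := by
  obtain ⟨z, hz, rfl⟩ := List.mem_map.1 hp
  obtain ⟨w, hw, rfl⟩ := List.mem_map.1 hq
  obtain ⟨A, hA, hA1, hA2⟩ := h.cover z hz
  obtain ⟨B, hB, hB1, hB2⟩ := h.cover w hw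
  rw [h.fittedValue_eq hA hA1 hA2, h.fittedValue_eq hB hB1 hB2]
  by_cases hAB : A = B
  · rw [hAB]
  have := rel_or_rel_of_pairwise
    (h.sep.and (pairwise_lt_of_not_poolStep hT)) hA hB hAB
  rcases this with h' | h'
  · exact h'.2.le
  · exact absurd h'.1 (not_lt.2 (hA1.trans (hpq.trans hB2)))

theorem le_of_getLast?_filter {X : List unitInterval} (hX : X.Pairwise (· ≤ ·))
    {p : unitInterval → Bool} {a q : unitInterval} (ha : (X.filter p).getLast? = some a)
    (hq : q ∈ X) (hpq : p q) : q ≤ a := by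
  have hm : q ∈ X.filter p := List.mem_filter.2 ⟨hq, hpq⟩
  have hs := hX.filter p
  obtain ⟨l, hl⟩ := List.getLast?_eq_some_iff.1 ha
  rw [hl] at hm hs
  rw [List.pairwise_append] at hs
  rcases List.mem_append.1 hm with h | h
  · exact hs.2.2 q h a (by simp)
  · simp only [List.mem_singleton] at h
    exact h.le

theorem le_of_head?_filter {X : List unitInterval} (hX : X.Pairwise (· ≤ ·))
    {p : unitInterval → Bool} {b q : unitInterval} (hb : (X.filter p).head? = some b)
    (hq : q ∈ X) (hpq : p q) : b ≤ q := by
  have hm : q ∈ X.filter p := List.mem_filter.2 ⟨hq, hpq⟩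
  have hs := hX.filter p
  obtain ⟨l, hl⟩ := List.head?_eq_some_iff.1 hb
  rw [hl] at hm hs
  rw [List.pairwise_cons] at hs
  rcases List.mem_cons.1 hm with h | h
  · exact h.ge
  · exact hs.1 q h

theorem mem_of_getLast?_filter {X : List unitInterval} {p : unitInterval → Bool}
    {a : unitInterval} (ha : (X.filter p).getLast? = some a) : a ∈ X ∧ p a :=
  List.mem_filter.1 (List.mem_of_getLast? ha)

theorem mem_of_head?_filter {X : List unitInterval} {p : unitInterval → Bool}
    {a : unitInterval} (ha : (X.filter p).head? = some a) : a ∈ X ∧ p a :=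
  List.mem_filter.1 (List.mem_of_head? ha)

theorem interpolation_le_fittedValue {O : List Sample}
    {T : List (unitInterval × unitInterval)} (hO : O.Pairwise fun z w => z.1 ≤ w.1)
    (h : IsPartition O T) (hT : ¬ ∃ t, PoolStep O T t) {x q : unitInterval}
    (hq : q ∈ O.map Prod.fst) (hxq : x ≤ q) : interpolation O T x ≤ fittedValue O T q := by
  have hX : (O.map Prod.fst).Pairwise (· ≤ ·) := List.pairwise_map.2 hO
  unfold interpolation
  split
  · rename_i a b ha hb
    obtain ⟨ha1, ha2⟩ := mem_of_getLast?_filter ha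
    obtain ⟨hb1, hb2⟩ := mem_of_head?_filter hb
    have hbq := le_of_head?_filter hX hb hq (by simpa using hxq)
    simp only [decide_eq_true_eq] at ha2 hb2
    have h1 := fittedValue_mono h hT ha1 hb1 (ha2.trans hb2)
    have h2 := fittedValue_mono h hT hb1 hq hbq
    have h1r : (a : ℝ) ≤ x := ha2
    have h2r : (x : ℝ) ≤ b := hb2
    -- The bound also covers a = b = x, where division by zero makes the quotient 0.
    have ht1 : ((x : ℝ) - (a : ℝ)) / ((b : ℝ) - (a : ℝ)) ≤ 1 :=
      div_le_one_of_le₀ (by linarith) (by linarith)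
    nlinarith
  · rename_i a ha hb
    rw [List.head?_eq_none_iff, List.filter_eq_nil_iff] at hb
    exact absurd (by simpa using hxq) (hb q hq)
  · rename_i b ha hb
    exact fittedValue_mono h hT (mem_of_head?_filter hb).1 hq
      (le_of_head?_filter hX hb hq (by simpa using hxq))
  · rename_i ha hb
    rw [List.head?_eq_none_iff, List.filter_eq_nil_iff] at hb
    exact absurd (by simpa using hxq) (hb q hq)

theorem fittedValue_le_interpolation {O : List Sample}
    {T : List (unitInterval × unitInterval)} (hO : O.Pairwise fun z w => z.1 ≤ w.1)
    (h : IsPartition O T) (hT : ¬ ∃ t, PoolStep O T t) {x q : unitInterval}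
    (hq : q ∈ O.map Prod.fst) (hxq : q ≤ x) : fittedValue O T q ≤ interpolation O T x := by
  have hX : (O.map Prod.fst).Pairwise (· ≤ ·) := List.pairwise_map.2 hO
  unfold interpolation
  split
  · rename_i a b ha hb
    obtain ⟨ha1, ha2⟩ := mem_of_getLast?_filter ha
    obtain ⟨hb1, hb2⟩ := mem_of_head?_filter hb
    have hbq := le_of_getLast?_filter hX ha hq (by simpa using hxq)
    simp only [decide_eq_true_eq] at ha2 hb2
    have h1 := fittedValue_mono h hT ha1 hb1 (ha2.trans hb2)
    have h2 := fittedValue_mono h hT hq ha1 hbq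
    have h1r : (a : ℝ) ≤ x := ha2
    have h2r : (x : ℝ) ≤ b := hb2
    have ht1 : 0 ≤ ((x : ℝ) - (a : ℝ)) / ((b : ℝ) - (a : ℝ)) :=
      div_nonneg (by linarith) (by linarith)
    nlinarith
  · rename_i a ha hb
    exact fittedValue_mono h hT hq (mem_of_getLast?_filter ha).1
      (le_of_getLast?_filter hX ha hq (by simpa using hxq))
  · rename_i b ha hb
    rw [List.getLast?_eq_none_iff, List.filter_eq_nil_iff] at ha
    exact absurd (by simpa using hxq) (ha q hq)
  · rename_i ha hb
    rw [List.getLast?_eq_none_iff, List.filter_eq_nil_iff] at ha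
    exact absurd (by simpa using hxq) (ha q hq)

/-- If a sample point lies between x and y, the fitted value there separates the two values.
Otherwise x and y have the same neighbouring sample points and are compared on one segment. -/
theorem interpolation_mono {O : List Sample}
    {T : List (unitInterval × unitInterval)} (hO : O.Pairwise fun z w => z.1 ≤ w.1)
    (h : IsPartition O T) (hT : ¬ ∃ t, PoolStep O T t) : Monotone (interpolation O T) := by
  intro x y hxy
  by_cases hq : ∃ q ∈ O.map Prod.fst, x ≤ q ∧ q ≤ y
  · obtain ⟨q, hq, h1, h2⟩ := hq
    exact (interpolation_le_fittedValue hO h hT hq h1).trans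
      (fittedValue_le_interpolation hO h hT hq h2)
  push Not at hq
  have e1 : (O.map Prod.fst).filter (fun q => decide (q ≤ x))
      = (O.map Prod.fst).filter fun q => decide (q ≤ y) := by
    refine List.filter_congr fun q hqO => ?_
    rw [decide_eq_decide]
    refine ⟨fun h => h.trans hxy, fun h => ?_⟩
    by_contra hc
    exact absurd h (not_le.2 (hq q hqO (not_le.1 hc).le))
  have e2 : (O.map Prod.fst).filter (fun q => decide (x ≤ q))
      = (O.map Prod.fst).filter fun q => decide (y ≤ q) := by
    refine List.filter_congr fun q hqO => ?_
    rw [decide_eq_decide]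
    exact ⟨fun h => (hq q hqO h).le, fun h => hxy.trans h⟩
  unfold interpolation
  rw [e1, e2]
  split
  · rename_i a b ha hb
    obtain ⟨ha1, ha2⟩ := mem_of_getLast?_filter ha
    obtain ⟨hb1, hb2⟩ := mem_of_head?_filter hb
    simp only [decide_eq_true_eq] at ha2 hb2
    have h1 := fittedValue_mono h hT ha1 hb1 (ha2.trans hb2)
    have h1r : (a : ℝ) ≤ y := ha2
    have h2r : (y : ℝ) ≤ b := hb2
    have h3 : (x : ℝ) ≤ y := hxy
    have : ((x : ℝ) - (a : ℝ)) / ((b : ℝ) - (a : ℝ)) ≤ ((y : ℝ) - (a : ℝ)) / ((b : ℝ) - (a : ℝ)) :=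
      div_le_div_of_nonneg_right (by linarith) (by linarith)
    nlinarith
  · exact le_rfl
  · exact le_rfl
  · exact hxy

theorem interpolation_eq_fittedValue {O : List Sample}
    {T : List (unitInterval × unitInterval)} (hO : O.Pairwise fun z w => z.1 ≤ w.1)
    (h : IsPartition O T) (hT : ¬ ∃ t, PoolStep O T t) {q : unitInterval}
    (hq : q ∈ O.map Prod.fst) : interpolation O T q = fittedValue O T q :=
  le_antisymm (interpolation_le_fittedValue hO h hT hq le_rfl)
    (fittedValue_le_interpolation hO h hT hq le_rfl)

theorem IsPAVOutput.mem_MPlus {S O : List Sample} {T : List (unitInterval × unitInterval)}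
    (h : IsPAVOutput S O T) : postProcessing O T ∈ MPlus := by
  obtain ⟨-, hO, hr, hT⟩ := h
  intro x y hxy
  exact interpolation_mono hO (invariant_of_reachable hO hr).1 hT hxy

theorem IsPAVOutput.empiricalLoss_le {S O : List Sample}
    {T : List (unitInterval × unitInterval)} (h : IsPAVOutput S O T)
    {l : unitInterval → Bool → ℝ} (hl : IsProper l) {k : unitInterval → unitInterval}
    (hk : k ∈ MPlus) : empiricalLoss l S (postProcessing O T) ≤ empiricalLoss l S k := by
  obtain ⟨hp, hO, hr, hT⟩ := h
  obtain ⟨hP, hc⟩ := invariant_of_reachable hO hr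
  unfold empiricalLoss
  rw [← (hp.map _).sum_eq, ← (hp.map _).sum_eq, sum_eq_sum_intervals hP.sep _ O hP.cover,
    sum_eq_sum_intervals hP.sep _ O hP.cover]
  refine List.sum_le_sum fun A hA => ?_
  refine le_trans (le_of_eq ?_) (hl.sum_le_of_isCalibrated (hP.nonempty A hA) (hc A hA) hk)
  refine congrArg List.sum (List.map_congr_left fun z hz => ?_)
  obtain ⟨hz, h1, h2⟩ := mem_inInterval.1 hz
  congr 1
  refine Subtype.ext ?_
  change interpolation O T z.1 = intervalMean O A
  rw [interpolation_eq_fittedValue hO hP hT (List.mem_map_of_mem hz), hP.fittedValue_eq hA h1 h2]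

theorem IsPAVOutput.isLeast {S O : List Sample} {T : List (unitInterval × unitInterval)}
    (h : IsPAVOutput S O T) {l : unitInterval → Bool → ℝ} (hl : IsProper l) :
    IsLeast ((fun k => empiricalLoss l S k) '' MPlus)
      (empiricalLoss l S (postProcessing O T)) := by
  refine ⟨⟨_, h.mem_MPlus, rfl⟩, ?_⟩
  rintro _ ⟨k, hk, rfl⟩
  exact h.empiricalLoss_le hl hk

/-! ### Correctness and running time of the implementation -/

@[simp] theorem Timed.val_bind {α β : Type} (x : Timed α) (f : α → Timed β) :
    (x >>= f).val = (f x.val).val := rfl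

@[simp] theorem Timed.time_bind {α β : Type} (x : Timed α) (f : α → Timed β) :
    (x >>= f).time = x.time + (f x.val).time := rfl

@[simp] theorem Timed.val_pure {α : Type} (a : α) : (pure a : Timed α).val = a := rfl

@[simp] theorem Timed.time_pure {α : Type} (a : α) : (pure a : Timed α).time = 0 := rfl

@[simp] theorem tick_time : tick.time = 1 := rfl

theorem lengthT_val {α : Type} (l : List α) : (lengthT l).val = l.length := by
  induction l with
  | nil => rfl
  | cons a l ih => simp [lengthT, addT, ih]

theorem lengthT_time {α : Type} (l : List α) : (lengthT l).time = 2 * l.length + 1 := by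
  induction l with
  | nil => rfl
  | cons a l ih => simp only [lengthT, addT, Timed.time_bind, tick_time, ih, List.length_cons]; ring

theorem reverseT_val {α : Type} (l acc : List α) : (reverseT l acc).val = l.reverse ++ acc := by
  induction l generalizing acc with
  | nil => rfl
  | cons a l ih => simp [reverseT, consT, ih]

theorem reverseT_time {α : Type} (l acc : List α) : (reverseT l acc).time = 2 * l.length + 1 := by
  induction l generalizing acc with
  | nil => rfl
  | cons a l ih =>
    simp only [reverseT, consT, Timed.time_bind, tick_time, ih, List.length_cons]; ring

/-! ### Merge sort. -/

theorem mergeT_nil (ys : List Sample) : mergeT [] ys = ⟨ys, 1⟩ := by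
  rw [mergeT]; rfl

theorem mergeT_cons_nil (x : Sample) (xs : List Sample) : mergeT (x :: xs) [] = ⟨x :: xs, 1⟩ := by
  rw [mergeT]; rfl

theorem mergeT_cons_cons (x y : Sample) (xs ys : List Sample) :
    mergeT (x :: xs) (y :: ys) = if x.1 ≤ y.1
      then ⟨x :: (mergeT xs (y :: ys)).val, (mergeT xs (y :: ys)).time + 3⟩
      else ⟨y :: (mergeT (x :: xs) ys).val, (mergeT (x :: xs) ys).time + 3⟩ := by
  rw [mergeT]
  by_cases h : x.1 ≤ y.1
  · have h' : ((x.1 : ℝ) ≤ y.1) := h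
    simp only [if_pos h]
    change Timed.mk _ _ = _
    simp [leT, h', consT]
    omega
  · have h' : ¬ ((x.1 : ℝ) ≤ y.1) := h
    simp only [if_neg h]
    change Timed.mk _ _ = _
    simp [leT, h', consT]
    omega

theorem mergeT_spec : ∀ (n : ℕ) (xs ys : List Sample), xs.length + ys.length = n →
    (mergeT xs ys).val.Perm (xs ++ ys) ∧ (mergeT xs ys).time ≤ 3 * n + 1 ∧
    ((xs.Pairwise fun z w => z.1 ≤ w.1) → (ys.Pairwise fun z w => z.1 ≤ w.1) →
      (mergeT xs ys).val.Pairwise fun z w => z.1 ≤ w.1) := by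
  intro n
  induction n with
  | zero =>
    intro xs ys h
    obtain rfl : xs = [] := List.length_eq_zero_iff.1 (by omega)
    simp [mergeT_nil]
  | succ n ih =>
    intro xs ys h
    match xs, ys, h with
    | [], ys, h => simp [mergeT_nil]
    | x :: xs, [], h => simp [mergeT_cons_nil]
    | x :: xs, y :: ys, h =>
      rw [mergeT_cons_cons]
      simp only [List.length_cons] at h
      by_cases hxy : x.1 ≤ y.1
      · obtain ⟨h1, h2, h3⟩ := ih xs (y :: ys) (by simp only [List.length_cons]; omega)
        rw [if_pos hxy]
        refine ⟨h1.cons x, by simp only; omega, fun hx hy => ?_⟩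
        rw [List.pairwise_cons] at hx ⊢
        refine ⟨fun z hz => ?_, h3 hx.2 hy⟩
        rcases List.mem_append.1 (h1.mem_iff.1 hz) with hz | hz
        · exact hx.1 z hz
        · rw [List.pairwise_cons] at hy
          rcases List.mem_cons.1 hz with rfl | hz
          · exact hxy
          · exact hxy.trans (hy.1 z hz)
      · obtain ⟨h1, h2, h3⟩ := ih (x :: xs) ys (by simp only [List.length_cons]; omega)
        rw [if_neg hxy]
        refine ⟨(h1.cons y).trans List.perm_middle.symm, by simp only; omega, fun hx hy => ?_⟩
        rw [List.pairwise_cons] at hy ⊢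
        refine ⟨fun z hz => ?_, h3 hx hy.2⟩
        have hyx := (not_le.1 hxy).le
        rcases List.mem_append.1 (h1.mem_iff.1 hz) with hz | hz
        · rw [List.pairwise_cons] at hx
          rcases List.mem_cons.1 hz with rfl | hz
          · exact hyx
          · exact hyx.trans (hx.1 z hz)
        · exact hy.1 z hz

theorem sortT_zero (l : List Sample) : sortT 0 l = ⟨([], l), 1⟩ := by
  rw [sortT]; rfl

theorem sortT_one (x : Sample) (l : List Sample) : sortT 1 (x :: l) = ⟨([x], l), 2⟩ := by
  rw [sortT]; rfl

theorem sortT_add_two_val (n : ℕ) (l : List Sample) :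
    (sortT (n + 2) l).val =
      ((mergeT (sortT ((n + 2) / 2) l).val.1 (sortT ((n + 2) - (n + 2) / 2)
        (sortT ((n + 2) / 2) l).val.2).val.1).val,
        (sortT ((n + 2) - (n + 2) / 2) (sortT ((n + 2) / 2) l).val.2).val.2) := by
  rw [sortT]; rfl

theorem sortT_add_two_time (n : ℕ) (l : List Sample) :
    (sortT (n + 2) l).time = 3 + (sortT ((n + 2) / 2) l).time
      + (sortT ((n + 2) - (n + 2) / 2) (sortT ((n + 2) / 2) l).val.2).time
      + (mergeT (sortT ((n + 2) / 2) l).val.1 (sortT ((n + 2) - (n + 2) / 2)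
        (sortT ((n + 2) / 2) l).val.2).val.1).time := by
  rw [sortT]
  simp only [Timed.time_bind, tick_time, Timed.time_pure]
  ring

/-- The merge and the overhead at one level cost at most 3n + 4 ≤ 5n for n ≥ 2, and `Nat.clog` drops
by exactly one on the larger half. -/
theorem sortT_spec (n : ℕ) : ∀ l : List Sample, n ≤ l.length →
    (sortT n l).val.1.Perm (l.take n) ∧ (sortT n l).val.2 = l.drop n ∧
    ((sortT n l).val.1.Pairwise fun z w => z.1 ≤ w.1) ∧
    (1 ≤ n → (sortT n l).time ≤ 5 * n * Nat.clog 2 n + 2 * n) := by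
  induction n using Nat.strong_induction_on with
  | _ n ih =>
    intro l hl
    match n, ih, hl with
    | 0, _, _ => simp [sortT_zero]
    | 1, _, hl =>
      cases l with
      | nil => simp at hl
      | cons x l => simp [sortT_one]
    | n + 2, ih, hl =>
      obtain ⟨a1, a2, a3, a4⟩ := ih ((n + 2) / 2) (by omega) l (by omega)
      obtain ⟨b1, b2, b3, b4⟩ := ih ((n + 2) - (n + 2) / 2) (by omega)
        (sortT ((n + 2) / 2) l).val.2 (by rw [a2, List.length_drop]; omega)
      rw [sortT_add_two_val, sortT_add_two_time]
      obtain ⟨m1, m2, m3⟩ := mergeT_spec _ (sortT ((n + 2) / 2) l).val.1 _ rfl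
      refine ⟨(m1.trans (a1.append b1)).trans ?_, ?_, m3 a3 b3, fun _ => ?_⟩
      · rw [a2, ← List.take_add]
        refine List.Perm.of_eq (congrArg (fun k => l.take k) ?_)
        omega
      · simp only
        rw [b2, a2, List.drop_drop]
        refine congrArg (fun k => l.drop k) ?_
        omega
      · have a4 := a4 (by omega)
        have b4 := b4 (by omega)
        have hlen : (sortT ((n + 2) / 2) l).val.1.length +
            (sortT ((n + 2) - (n + 2) / 2) (sortT ((n + 2) / 2) l).val.2).val.1.length
            = n + 2 := by
          rw [a1.length_eq, b1.length_eq, a2]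
          simp only [List.length_take, List.length_drop]
          omega
        rw [hlen] at m2
        have hc : Nat.clog 2 (n + 2) = Nat.clog 2 ((n + 2) - (n + 2) / 2) + 1 := by
          rw [Nat.clog_of_two_le (by norm_num) (by omega)]
          congr 2
          omega
        have hm : Nat.clog 2 ((n + 2) / 2) ≤ Nat.clog 2 ((n + 2) - (n + 2) / 2) :=
          Nat.clog_mono_right 2 (by omega)
        rw [hc]
        set c := Nat.clog 2 ((n + 2) - (n + 2) / 2)
        have h1 : 5 * ((n + 2) / 2) * Nat.clog 2 ((n + 2) / 2) ≤ 5 * ((n + 2) / 2) * c :=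
          Nat.mul_le_mul_left _ hm
        have h2 : 5 * ((n + 2) / 2) * c + 5 * ((n + 2) - (n + 2) / 2) * c = 5 * (n + 2) * c := by
          rw [← add_mul, ← mul_add]
          congr 2
          omega
        have h3 : 5 * (n + 2) * (c + 1) = 5 * (n + 2) * c + 5 * (n + 2) := by ring
        omega

/-- The sum and the count recorded in a block are those of its interval. -/
def Block.IsFaithful (O : List Sample) (b : Block) : Prop :=
  b.sum = ((inInterval O b.interval).map fun z => label z.2).sum ∧
    b.cnt = (inInterval O b.interval).length

theorem Block.IsFaithful.mean_eq {O : List Sample} {b : Block} (h : b.IsFaithful O) :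
    b.mean = intervalMean O b.interval := by
  unfold Block.mean intervalMean
  rw [h.1, h.2]

/-! ### Initial blocks. -/

theorem groupAuxT_nil (b : Block) : groupAuxT b [] = ⟨[b], 2⟩ := by
  rw [groupAuxT]; rfl

theorem groupAuxT_cons (b : Block) (z : Sample) (zs : List Sample) :
    groupAuxT b (z :: zs) = if b.hi = z.1
      then ⟨(groupAuxT ⟨b.lo, b.hi, b.sum + label z.2, b.cnt + 1⟩ zs).val,
        (groupAuxT ⟨b.lo, b.hi, b.sum + label z.2, b.cnt + 1⟩ zs).time + 4⟩
      else ⟨b :: (groupAuxT ⟨z.1, z.1, label z.2, 1⟩ zs).val,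
        (groupAuxT ⟨z.1, z.1, label z.2, 1⟩ zs).time + 3⟩ := by
  rw [groupAuxT]
  by_cases h : b.hi = z.1
  · have h' : ((b.hi : ℝ) = z.1) := congrArg _ h
    simp only [if_pos h]
    change Timed.mk _ _ = _
    simp [eqT, h', addT]
    omega
  · have h' : ¬ ((b.hi : ℝ) = z.1) := fun h' => h (Subtype.ext h')
    simp only [if_neg h]
    change Timed.mk _ _ = _
    simp [eqT, h', consT]
    omega

theorem groupAuxT_time (zs : List Sample) : ∀ b : Block,
    (groupAuxT b zs).time ≤ 4 * zs.length + 2 ∧ (groupAuxT b zs).val.length ≤ zs.length + 1 := by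
  induction zs with
  | nil => intro b; simp [groupAuxT_nil]
  | cons z zs ih =>
    intro b
    rw [groupAuxT_cons]
    split
    · have := ih ⟨b.lo, b.hi, b.sum + label z.2, b.cnt + 1⟩
      simp only [List.length_cons]
      omega
    · have := ih ⟨z.1, z.1, label z.2, 1⟩
      simp only [List.length_cons]
      omega

theorem groupAuxT_interval (zs : List Sample) : ∀ b : Block, b.lo = b.hi →
    (b.hi :: zs.map Prod.fst).Pairwise (· ≤ ·) →
    (groupAuxT b zs).val.map Block.interval
      = ((b.hi :: zs.map Prod.fst).dedup).map fun p => (p, p) := by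
  induction zs with
  | nil => intro b hb _; simp [groupAuxT_nil, Block.interval, hb]
  | cons z zs ih =>
    intro b hb hs
    rw [groupAuxT_cons]
    simp only [List.map_cons] at hs ⊢
    split
    · rename_i h
      -- `List.dedup` keeps the last occurrence, so it drops the head exactly when the algorithm
      -- absorbs the next sample into the current block.
      rw [List.dedup_cons_of_mem (by simp [h]), ← h]
      refine ih ⟨b.lo, b.hi, b.sum + label z.2, b.cnt + 1⟩ hb ?_
      rw [← h] at hs
      exact (List.pairwise_cons.1 hs).2
    · rename_i h
      have hs' := List.pairwise_cons.1 hs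
      have hnot : b.hi ∉ z.1 :: zs.map Prod.fst := by
        intro hm
        rcases List.mem_cons.1 hm with hm | hm
        · exact h hm
        · exact h (le_antisymm (hs'.1 _ (by simp)) ((List.pairwise_cons.1 hs'.2).1 _ hm))
      rw [List.dedup_cons_of_notMem hnot]
      simp only [List.map_cons]
      rw [ih ⟨z.1, z.1, label z.2, 1⟩ rfl hs'.2]
      simp [Block.interval, hb]

/-- Here ws holds the samples already absorbed into b. The bound b.hi ≤ c.lo is carried along
because it shows, once a new block starts strictly to the right, that later blocks contain none of
ws. -/
theorem groupAuxT_isFaithful (zs : List Sample) : ∀ (b : Block) (ws : List Sample), b.lo = b.hi →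
    (b.hi :: zs.map Prod.fst).Pairwise (· ≤ ·) → (∀ z ∈ ws, z.1 = b.hi) →
    b.sum = (ws.map fun z => label z.2).sum → b.cnt = ws.length →
    ∀ c ∈ (groupAuxT b zs).val, b.hi ≤ c.lo ∧ c.IsFaithful (ws ++ zs) := by
  induction zs with
  | nil =>
    intro b ws hb _ hw h1 h2 c hc
    simp only [groupAuxT_nil, List.mem_singleton] at hc
    subst hc
    have : inInterval (ws ++ []) c.interval = ws := by
      rw [List.append_nil]
      refine List.filter_eq_self.2 fun z hz => ?_
      simp [Block.interval, hb, hw z hz]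
    exact ⟨hb.ge, by rw [this, h1], by rw [this, h2]⟩
  | cons z zs ih =>
    intro b ws hb hs hw h1 h2 c hc
    rw [groupAuxT_cons] at hc
    simp only [List.map_cons] at hs
    have hs' := List.pairwise_cons.1 hs
    split at hc
    · rename_i h
      have := ih ⟨b.lo, b.hi, b.sum + label z.2, b.cnt + 1⟩ (ws ++ [z]) hb
        (by rw [h]; exact hs'.2)
        (by simp only [List.mem_append, List.mem_singleton]; rintro w (hw' | rfl)
            · exact hw w hw'
            · exact h.symm) (by simp [h1]) (by simp [h2]) c hc
      rw [List.append_assoc] at this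
      exact this
    · rename_i h
      have hlt : b.hi < z.1 := lt_of_le_of_ne (hs'.1 _ (by simp)) h
      rcases List.mem_cons.1 hc with rfl | hc
      · have : inInterval (ws ++ z :: zs) c.interval = ws := by
          unfold inInterval
          rw [List.filter_append, List.filter_eq_self.2, List.filter_eq_nil_iff.2, List.append_nil]
          · intro w hwz
            have : z.1 ≤ w.1 := by
              rcases List.mem_cons.1 hwz with rfl | hwz
              · exact le_rfl
              · exact (List.pairwise_cons.1 hs'.2).1 _ (List.mem_map_of_mem hwz)
            intro h4
            exact absurd (hlt.trans_le this) (not_lt.2 (of_decide_eq_true h4).2)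
          · intro w hw'
            simp [Block.interval, hb, hw w hw']
        exact ⟨hb.ge, by rw [this, h1], by rw [this, h2]⟩
      · have := ih ⟨z.1, z.1, label z.2, 1⟩ [z] rfl hs'.2 (by simp) (by simp) (by simp) c hc
        refine ⟨hlt.le.trans this.1, ?_⟩
        have e : inInterval (ws ++ z :: zs) c.interval = inInterval ([z] ++ zs) c.interval := by
          unfold inInterval
          rw [List.filter_append, List.filter_eq_nil_iff.2, List.nil_append]
          · rfl
          · intro w hw'
            have h3 := this.1
            simp only at h3
            intro h4
            exact absurd (hlt.trans_le (h3.trans (of_decide_eq_true h4).1)) (by rw [hw w hw']; exact lt_irrefl _)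
        unfold Block.IsFaithful
        rw [e]
        exact this.2

theorem groupT_spec {O : List Sample} (hO : O.Pairwise fun z w => z.1 ≤ w.1) :
    (groupT O).val.map Block.interval = initialIntervals O ∧
    (∀ c ∈ (groupT O).val, c.IsFaithful O) ∧
    (groupT O).time ≤ 4 * O.length + 1 ∧ (groupT O).val.length ≤ O.length := by
  cases O with
  | nil => simp [groupT, initialIntervals]
  | cons z zs =>
    have hs : (z.1 :: zs.map Prod.fst).Pairwise (· ≤ ·) := List.pairwise_map.2 hO
    have hv : (groupT (z :: zs)).val = (groupAuxT ⟨z.1, z.1, label z.2, 1⟩ zs).val := rfl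
    have ht : (groupT (z :: zs)).time = 1 + (groupAuxT ⟨z.1, z.1, label z.2, 1⟩ zs).time := rfl
    rw [hv, ht]
    have hb := groupAuxT_time zs ⟨z.1, z.1, label z.2, 1⟩
    refine ⟨groupAuxT_interval zs ⟨z.1, z.1, label z.2, 1⟩ rfl hs, fun c hc => ?_, ?_, hb.2⟩
    · exact (groupAuxT_isFaithful zs ⟨z.1, z.1, label z.2, 1⟩ [z] rfl hs (by simp) (by simp)
        (by simp) c hc).2
    · simp only [List.length_cons]
      omega

/-! ### The stack: amortized cost and correctness. -/

theorem pushT_nil (b : Block) : pushT b [] = ⟨[b], 2⟩ := by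
  rw [pushT]; rfl

theorem pushT_cons (b a : Block) (st : List Block) :
    pushT b (a :: st) = if b.mean ≤ a.mean
      then ⟨(pushT ⟨a.lo, b.hi, a.sum + b.sum, a.cnt + b.cnt⟩ st).val,
        (pushT ⟨a.lo, b.hi, a.sum + b.sum, a.cnt + b.cnt⟩ st).time + 6⟩
      else ⟨b :: a :: st, 5⟩ := by
  rw [pushT]
  unfold Block.mean
  split
  · rename_i h
    change Timed.mk _ _ = _
    simp [leT, divT, h, addT]
    omega
  · rename_i h
    change Timed.mk _ _ = _
    simp [leT, divT, h, consT]

/-- Amortization with potential six times the stack height: a pooling step costs 6 and removes one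
block, while the final placement costs at most 5 and raises the potential by 6. -/
theorem pushT_time (st : List Block) : ∀ b : Block,
    (pushT b st).time + 6 * (pushT b st).val.length ≤ 6 * st.length + 11 ∧
      (pushT b st).val.length ≤ st.length + 1 := by
  induction st with
  | nil => intro b; simp [pushT_nil]
  | cons a st ih =>
    intro b
    rw [pushT_cons]
    split
    · have := ih ⟨a.lo, b.hi, a.sum + b.sum, a.cnt + b.cnt⟩
      simp only [List.length_cons]
      omega
    · simp only [List.length_cons]
      omega

theorem poolT_nil (st : List Block) : poolT st [] = ⟨st, 1⟩ := by
  rw [poolT]; rfl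

theorem poolT_cons_val (st : List Block) (b : Block) (bs : List Block) :
    (poolT st (b :: bs)).val = (poolT (pushT b st).val bs).val := by
  rw [poolT]; rfl

theorem poolT_cons_time (st : List Block) (b : Block) (bs : List Block) :
    (poolT st (b :: bs)).time = 1 + (pushT b st).time + (poolT (pushT b st).val bs).time := by
  rw [poolT]; simp; ring

theorem poolT_time (bs : List Block) : ∀ st : List Block,
    (poolT st bs).time + 6 * (poolT st bs).val.length ≤ 6 * st.length + 12 * bs.length + 1 ∧
      (poolT st bs).val.length ≤ st.length + bs.length := by
  induction bs with
  | nil => intro st; simp [poolT_nil]; omega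
  | cons b bs ih =>
    intro st
    rw [poolT_cons_val, poolT_cons_time]
    have h1 := pushT_time st b
    have h2 := ih (pushT b st).val
    simp only [List.length_cons]
    omega

theorem Block.IsFaithful.pool {O : List Sample} {L R : List (unitInterval × unitInterval)}
    {a b : Block} (hP : IsPartition O (L ++ a.interval :: b.interval :: R))
    (ha : a.IsFaithful O) (hb : b.IsFaithful O) :
    Block.IsFaithful O ⟨a.lo, b.hi, a.sum + b.sum, a.cnt + b.cnt⟩ := by
  have h := hP.pool_perm
  have e : Block.interval ⟨a.lo, b.hi, a.sum + b.sum, a.cnt + b.cnt⟩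
      = (a.interval.1, b.interval.2) := rfl
  unfold Block.IsFaithful
  rw [e, (h.map _).sum_eq, h.length_eq, List.map_append, List.sum_append, List.length_append,
    ha.1, ha.2, hb.1, hb.2]
  exact ⟨rfl, rfl⟩

theorem IsPartition.of_reachable {O : List Sample} {T T' : List (unitInterval × unitInterval)}
    (hT : IsPartition O T) (h : Relation.ReflTransGen (PoolStep O) T T') : IsPartition O T' := by
  induction h with
  | refl => exact hT
  | tail _ hst ih =>
    obtain ⟨L, A, B, R, rfl, -, rfl⟩ := hst
    exact ih.pool

/-- The current interval list is the reversed stack, then b, then the unread blocks R. Each pooling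
on the stack is a `PoolStep` of this list. Means decrease from the top of the stack downwards, so
once b exceeds the top, it exceeds the whole stack. -/
theorem pushT_spec {O : List Sample} (st : List Block) : ∀ (b : Block) (R : List Block),
    IsPartition O ((st.reverse ++ b :: R).map Block.interval) →
    (∀ c ∈ st, c.IsFaithful O) → b.IsFaithful O → (st.Pairwise fun a c => c.mean < a.mean) →
    Relation.ReflTransGen (PoolStep O) ((st.reverse ++ b :: R).map Block.interval)
      (((pushT b st).val.reverse ++ R).map Block.interval) ∧
    (∀ c ∈ (pushT b st).val, c.IsFaithful O) ∧
    ((pushT b st).val.Pairwise fun a c => c.mean < a.mean) := by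
  induction st with
  | nil =>
    intro b R _ _ hb _
    simpa [pushT_nil] using ⟨Relation.ReflTransGen.refl, hb⟩
  | cons a st ih =>
    intro b R hP hst hb hs
    rw [pushT_cons]
    have ha := hst a (by simp)
    split
    · rename_i hm
      rw [ha.mean_eq, hb.mean_eq] at hm
      have e : ((a :: st).reverse ++ b :: R).map Block.interval
          = st.reverse.map Block.interval ++ a.interval :: b.interval :: R.map Block.interval := by
        simp
      rw [e] at hP ⊢
      have hstep : PoolStep O
          (st.reverse.map Block.interval ++ a.interval :: b.interval :: R.map Block.interval)
          ((st.reverse ++ ⟨a.lo, b.hi, a.sum + b.sum, a.cnt + b.cnt⟩ :: R).map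
            Block.interval) :=
        ⟨_, _, _, _, rfl, hm, by simp [Block.interval]⟩
      obtain ⟨h1, h2, h3⟩ := ih ⟨a.lo, b.hi, a.sum + b.sum, a.cnt + b.cnt⟩ R
        (hP.of_reachable (.single hstep)) (fun c hc => hst c (by simp [hc]))
        (ha.pool hP hb) (List.pairwise_cons.1 hs).2
      exact ⟨.head hstep h1, h2, h3⟩
    · rename_i hm
      refine ⟨?_, ?_, ?_⟩
      · have e : ((b :: a :: st).reverse ++ R) = (a :: st).reverse ++ b :: R := by simp
        simp only [e]
        exact .refl
      · intro c hc
        rcases List.mem_cons.1 hc with rfl | hc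
        · exact hb
        · exact hst c hc
      · refine List.pairwise_cons.2 ⟨fun c hc => ?_, hs⟩
        rcases List.mem_cons.1 hc with rfl | hc
        · exact not_le.1 hm
        · exact ((List.pairwise_cons.1 hs).1 c hc).trans (not_le.1 hm)

theorem poolT_spec {O : List Sample} (bs : List Block) : ∀ st : List Block,
    IsPartition O ((st.reverse ++ bs).map Block.interval) →
    (∀ c ∈ st, c.IsFaithful O) → (∀ c ∈ bs, c.IsFaithful O) →
    (st.Pairwise fun a c => c.mean < a.mean) →
    Relation.ReflTransGen (PoolStep O) ((st.reverse ++ bs).map Block.interval)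
      ((poolT st bs).val.reverse.map Block.interval) ∧
    (∀ c ∈ (poolT st bs).val, c.IsFaithful O) ∧
    ((poolT st bs).val.Pairwise fun a c => c.mean < a.mean) := by
  induction bs with
  | nil =>
    intro st _ hst _ hs
    rw [poolT_nil, List.append_nil]
    exact ⟨.refl, hst, hs⟩
  | cons b bs ih =>
    intro st hP hst hbs hs
    obtain ⟨h1, h2, h3⟩ := pushT_spec st b bs hP hst (hbs b (by simp)) hs
    rw [poolT_cons_val]
    obtain ⟨g1, g2, g3⟩ := ih (pushT b st).val (hP.of_reachable h1) h2
      (fun c hc => hbs c (by simp [hc])) h3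
    exact ⟨h1.trans g1, g2, g3⟩

/-! ### The complete algorithm. -/

theorem pavT_val (S : List Sample) :
    (pavT S).val = ((sortT S.length S).val.1,
      (poolT [] (groupT (sortT S.length S).val.1).val).val.reverse) := by
  unfold pavT
  simp only [Timed.val_bind, Timed.val_pure, lengthT_val, reverseT_val, List.append_nil]

theorem pavT_time (S : List Sample) :
    (pavT S).time = 1 + (2 * S.length + 1) + (sortT S.length S).time
      + (groupT (sortT S.length S).val.1).time
      + (poolT [] (groupT (sortT S.length S).val.1).val).time
      + (2 * (poolT [] (groupT (sortT S.length S).val.1).val).val.length + 1) := by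
  unfold pavT
  simp only [Timed.time_bind, Timed.time_pure, lengthT_val, lengthT_time, reverseT_time, tick_time]
  ring

theorem not_poolStep_of_pairwise {O : List Sample} {T : List (unitInterval × unitInterval)}
    (h : T.Pairwise fun A B => intervalMean O A < intervalMean O B) : ¬ ∃ t, PoolStep O T t := by
  rintro ⟨t, L, A, B, R, rfl, hm, -⟩
  simp only [List.pairwise_append, List.pairwise_cons, List.mem_cons] at h
  exact absurd (h.2.1.1 B (Or.inl rfl)) (not_lt.2 hm)

theorem pavT_spec (S : List Sample) :
    IsPAVOutput S (pavT S).val.1 ((pavT S).val.2.map Block.interval) ∧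
      ∀ b ∈ (pavT S).val.2, b.mean = intervalMean (pavT S).val.1 b.interval := by
  rw [pavT_val]
  simp only
  obtain ⟨s1, -, s3, -⟩ := sortT_spec S.length S le_rfl
  rw [List.take_length] at s1
  obtain ⟨g1, g2, -, -⟩ := groupT_spec s3
  have hP := isPartition_initialIntervals s3
  rw [← g1] at hP
  obtain ⟨p1, p2, p3⟩ := poolT_spec (groupT (sortT S.length S).val.1).val [] hP (by simp) g2
    List.Pairwise.nil
  refine ⟨⟨s1, s3, ?_, not_poolStep_of_pairwise ?_⟩, fun b hb => ?_⟩
  · rw [← g1]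
    exact p1
  · rw [List.pairwise_map, List.pairwise_reverse]
    refine p3.imp_of_mem fun ha hb h => ?_
    rwa [(p2 _ ha).mean_eq, (p2 _ hb).mean_eq] at h
  · exact (p2 b (List.mem_reverse.1 hb)).mean_eq

theorem pavT_time_le (S : List Sample) (hS : 1 ≤ S.length) :
    (pavT S).time ≤ 5 * S.length * Nat.clog 2 S.length + 22 * S.length + 5 := by
  rw [pavT_time]
  obtain ⟨s1, -, s3, s4⟩ := sortT_spec S.length S le_rfl
  rw [List.take_length] at s1
  obtain ⟨-, -, g3, g4⟩ := groupT_spec s3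
  have p := poolT_time (groupT (sortT S.length S).val.1).val []
  rw [s1.length_eq] at g3 g4
  have := s4 hS
  simp only [List.length_nil] at p
  omega

/-- From 2^(clog - 1) < n, clog is below 1 + log n / log 2, and this is at most 2 log n / log 2 ≤ 3
log n. -/
theorem clog_two_le {n : ℕ} (hn : 2 ≤ n) : (Nat.clog 2 n : ℝ) ≤ 3 * Real.log n := by
  have h1 : 2 ^ (Nat.clog 2 n).pred < n := Nat.pow_pred_clog_lt_self (by norm_num) (by omega)
  have hpos : 0 < Nat.clog 2 n := Nat.clog_pos (by norm_num) hn
  have h2 : ((2 : ℝ) ^ (Nat.clog 2 n - 1)) < n := by exact_mod_cast h1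
  have h3 := Real.log_lt_log (by positivity) h2
  rw [Real.log_pow, Nat.cast_sub hpos] at h3
  have h4 := Real.log_two_gt_d9
  have h5 : Real.log 2 ≤ Real.log n := Real.log_le_log (by norm_num) (by exact_mod_cast hn)
  push_cast at h3
  have : (1 : ℝ) ≤ Nat.clog 2 n := by exact_mod_cast hpos
  nlinarith

theorem pavT_time_le_log (S : List Sample) (hS : 2 ≤ S.length) :
    ((pavT S).time : ℝ) ≤ 60 * ((S.length : ℝ) * Real.log (S.length : ℝ)) := by
  have h : ((pavT S).time : ℝ) ≤ 5 * S.length * Nat.clog 2 S.length + 22 * S.length + 5 := by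
    exact_mod_cast pavT_time_le S (by omega)
  have h1 := clog_two_le hS
  have h4 := Real.log_two_gt_d9
  have h5 : Real.log 2 ≤ Real.log S.length := Real.log_le_log (by norm_num) (by exact_mod_cast hS)
  have h6 : (2 : ℝ) ≤ S.length := by exact_mod_cast hS
  have h7 := mul_le_mul_of_nonneg_left h1 (show (0 : ℝ) ≤ 5 * S.length by positivity)
  have h8 : (S.length : ℝ) * 0.69 ≤ S.length * Real.log S.length :=
    mul_le_mul_of_nonneg_left (by linarith) (by positivity)
  linarith

open MeasureTheory Set

/-! ### Bracketing of upper sets -/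

/-- The quantile is the infimum of the t with c ≤ μ (Iic t). Inner regularity of the open ray below
it gives the first bound; outer regularity of the closed ray gives the second when the infimum is
not attained. Keeping one ray open and the other closed allows for atoms. -/
theorem exists_quantile (μ : Measure unitInterval) [IsFiniteMeasure μ] {c : ENNReal}
    (hc : c ≤ μ univ) : ∃ q, μ (Iio q) ≤ c ∧ c ≤ μ (Iic q) := by
  set s : Set unitInterval := {t | c ≤ μ (Iic t)} with hs
  have htop : ⊤ ∈ s := by simpa [hs] using hc
  refine ⟨sInf s, ?_, ?_⟩
  · rw [isOpen_Iio.measure_eq_iSup_isCompact μ]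
    refine iSup_le fun K => iSup_le fun hK => iSup_le fun hKc => ?_
    rcases K.eq_empty_or_nonempty with rfl | hne
    · simp
    · obtain ⟨t, ht, hmax⟩ := hKc.exists_isGreatest hne
      have : t ∉ s := notMem_of_lt_csInf (hK ht) (OrderBot.bddBelow s)
      exact (measure_mono hmax).trans (not_le.1 this).le
  · by_cases hq : sInf s ∈ s
    · exact hq
    rw [(Iic (sInf s)).measure_eq_iInf_isOpen μ]
    refine le_iInf fun U => le_iInf fun hU => le_iInf fun hUo => ?_
    have hlt : sInf s < ⊤ := lt_top_iff_ne_top.2 fun h => hq (h ▸ htop)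
    obtain ⟨u, hu, hsub⟩ := exists_Ico_subset_of_mem_nhds
      (hUo.mem_nhds (hU (mem_Iic.2 le_rfl))) ⟨⊤, hlt⟩
    obtain ⟨t, ht, htu⟩ := exists_lt_of_csInf_lt ⟨⊤, htop⟩ hu
    refine le_trans ht (measure_mono fun x hx => ?_)
    rcases le_total x (sInf s) with h | h
    · exact hU h
    · exact hsub ⟨h, lt_of_le_of_lt hx htu⟩

theorem exists_quantile_real (μ : Measure unitInterval) [IsFiniteMeasure μ] {c : ℝ}
    (hc : c ≤ μ.real univ) (h0 : 0 ≤ c) : ∃ q, μ.real (Iio q) ≤ c ∧ c ≤ μ.real (Iic q) := by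
  obtain ⟨q, h1, h2⟩ := exists_quantile μ (c := ENNReal.ofReal c)
    (by rw [← ofReal_measureReal]; exact ENNReal.ofReal_le_ofReal hc)
  refine ⟨q, ENNReal.toReal_le_of_le_ofReal h0 h1, ?_⟩
  rw [← ofReal_measureReal] at h2
  exact (ENNReal.ofReal_le_ofReal_iff measureReal_nonneg).1 h2

/-- With q k the k/N-quantile, an upper set whose first quantile inside is q j contains `Ici (q j)`
and is contained in `Ioi (q (j - 1))`. These rays differ in mass by at most 1/N even with atoms,
since any atoms at the two endpoints lie outside the difference. The ends j = 0 and j = N + 1 use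
`univ` and `∅`. -/
theorem exists_brackets (μ : Measure unitInterval) [IsFiniteMeasure μ] (hμ : μ.real univ ≤ 1)
    {N : ℕ} (hN : 0 < N) : ∃ U L : ℕ → Set unitInterval,
      (∀ j, MeasurableSet (U j)) ∧ (∀ j, MeasurableSet (L j)) ∧
      (∀ j < N + 2, μ.real (U j) ≤ μ.real (L j) + 1 / N) ∧
      ∀ A : Set unitInterval, IsUpperSet A → ∃ j < N + 2, L j ⊆ A ∧ A ⊆ U j := by
  have hN' : (0 : ℝ) < N := by exact_mod_cast hN
  have hq : ∀ k : ℕ, ∃ q, k ≤ N →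
      μ.real (Iio q) ≤ k / N * μ.real univ ∧ k / N * μ.real univ ≤ μ.real (Iic q) := by
    intro k
    by_cases hk : k ≤ N
    · have h1 : (k : ℝ) / N ≤ 1 := div_le_one_of_le₀ (by exact_mod_cast hk) hN'.le
      obtain ⟨q, hq⟩ := exists_quantile_real μ (c := k / N * μ.real univ)
        (mul_le_of_le_one_left measureReal_nonneg h1) (by positivity)
      exact ⟨q, fun _ => hq⟩
    -- Dummy value: only indices up to N matter.
    · exact ⟨0, fun h => absurd h hk⟩
  choose q hq using hq
  have hIoi : ∀ t, μ.real (Ioi t) = μ.real univ - μ.real (Iic t) := by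
    intro t
    rw [← compl_Iic, measureReal_compl measurableSet_Iic]
  have hIci : ∀ t, μ.real (Ici t) = μ.real univ - μ.real (Iio t) := by
    intro t
    rw [← compl_Iio, measureReal_compl measurableSet_Iio]
  refine ⟨fun j => if j = 0 then univ else Ioi (q (j - 1)),
    fun j => if j = N + 1 then ∅ else Ici (q j), ?_, ?_, ?_, ?_⟩
  · intro j
    beta_reduce
    split
    · exact MeasurableSet.univ
    · exact measurableSet_Ioi
  · intro j
    beta_reduce
    split
    · exact MeasurableSet.empty
    · exact measurableSet_Ici
  · intro j hj
    have hN1 : 0 ≤ 1 / (N : ℝ) := by positivity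
    rcases Nat.eq_zero_or_pos j with rfl | hj0
    · have h := (hq 0 (Nat.zero_le _)).1
      simp only [Nat.cast_zero, zero_div, zero_mul] at h
      beta_reduce
      rw [if_pos rfl, if_neg (by omega), hIci]
      linarith
    · obtain ⟨i, rfl⟩ : ∃ i, j = i + 1 := ⟨j - 1, by omega⟩
      have h1 := (hq i (by omega)).2
      beta_reduce
      rw [if_neg (by omega), Nat.add_sub_cancel, hIoi]
      by_cases hi : i = N
      · subst hi
        rw [div_self hN'.ne', one_mul] at h1
        rw [if_pos rfl, measureReal_empty]
        linarith
      · have h2 := (hq (i + 1) (by omega)).1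
        rw [if_neg (by omega), hIci]
        push_cast at h2
        rw [add_div, add_mul] at h2
        have : 1 / (N : ℝ) * μ.real univ ≤ 1 / N := mul_le_of_le_one_right hN1 hμ
        linarith
  · intro A hA
    classical
    -- The alternative k = N + 1 makes the search succeed when no quantile lies in A.
    have hex : ∃ k, k = N + 1 ∨ q k ∈ A := ⟨N + 1, Or.inl rfl⟩
    refine ⟨Nat.find hex, ?_, ?_, ?_⟩
    · have := Nat.find_min' hex (Or.inl rfl)
      omega
    · beta_reduce
      split
      · exact empty_subset _
      · rename_i h
        have := (Nat.find_spec hex).resolve_left h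
        exact fun x hx => hA hx this
    · beta_reduce
      split
      · exact subset_univ _
      · rename_i h
        have := Nat.find_min hex (Nat.sub_one_lt h)
        push Not at this
        intro x hx
        rw [mem_Ioi]
        by_contra hc
        exact this.2 (hA (not_lt.1 hc) hx)

/-! ### Integrals of monotone functions -/

theorem integrable_of_monotone (μ : Measure unitInterval) [IsFiniteMeasure μ]
    {g : unitInterval → ℝ} (hg : Monotone g) : Integrable g μ :=
  Integrable.of_mem_Icc (g ⊥) (g ⊤) hg.measurable.aemeasurable
    (Filter.Eventually.of_forall fun _ => ⟨hg bot_le, hg le_top⟩)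

/-- Layer cake: the integral of g is the integral over t in [0,K] of the masses of {t ≤ g}, and
these are upper sets. -/
theorem abs_integral_sub_le_of_monotone (μ ν : Measure unitInterval) [IsFiniteMeasure μ]
    [IsFiniteMeasure ν] {θ : ℝ} (h : ∀ A : Set unitInterval, IsUpperSet A →
      |μ.real A - ν.real A| ≤ θ) {g : unitInterval → ℝ} (hg : Monotone g) {K : ℝ}
    (h0 : ∀ x, 0 ≤ g x) (hK : ∀ x, g x ≤ K) : |∫ x, g x ∂μ - ∫ x, g x ∂ν| ≤ θ * K := by
  have hK0 : 0 ≤ K := (h0 0).trans (hK 0)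
  have key : ∀ (μ : Measure unitInterval) [IsFiniteMeasure μ],
      ∫ x, g x ∂μ = ∫ t in (0 : ℝ)..K, μ.real {a | t ≤ g a} := by
    intro μ _
    rw [(integrable_of_monotone μ hg).integral_eq_integral_Ioc_meas_le
      (Filter.Eventually.of_forall h0) (Filter.Eventually.of_forall hK),
      intervalIntegral.integral_of_le hK0]
  have hint : ∀ (μ : Measure unitInterval) [IsFiniteMeasure μ],
      IntervalIntegrable (fun t => μ.real {a | t ≤ g a}) volume 0 K := by
    intro μ _
    refine Antitone.intervalIntegrable fun s t hst => measureReal_mono fun a ha => ?_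
    exact hst.trans ha
  rw [key μ, key ν, ← intervalIntegral.integral_sub (hint μ) (hint ν)]
  have := intervalIntegral.norm_integral_le_of_norm_le_const (a := 0) (b := K) (C := θ)
    (f := fun t => μ.real {a | t ≤ g a} - ν.real {a | t ≤ g a})
    fun t _ => h _ fun a b hab ha => le_trans ha (hg hab)
  rwa [sub_zero, abs_of_nonneg hK0] at this

/-! ### Losses in `LStar` -/

theorem IsProper.monotone_false {l : unitInterval → Bool → ℝ} (hl : IsProper l) :
    Monotone fun p => l p false := by
  intro p q hpq
  have h1 := hl q p
  have h2 := hl.antitone_sub hpq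
  simp only [bernoulliExp] at h1 h2
  have := p.2.1
  nlinarith

theorem IsProper.antitone_true {l : unitInterval → Bool → ℝ} (hl : IsProper l) :
    Antitone fun p => l p true := by
  intro p q hpq
  have h1 := hl p q
  have h2 := hl.antitone_sub hpq
  simp only [bernoulliExp] at h1 h2
  have := q.2.2
  nlinarith

/-- Propriety at truth p against prediction 0 bounds the difference by p(D(0) - D(p)), where D =
l(·,1) - l(·,0) takes values in [-1,1]. -/
theorem false_sub_le_two {l : unitInterval → Bool → ℝ} (hl : l ∈ LStar) (p : unitInterval) :
    l p false - l 0 false ≤ 2 := by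
  have h1 := hl.1 0 p
  have h2 := abs_le.1 (hl.2 0)
  have h3 := abs_le.1 (hl.2 p)
  have h4 := hl.1.antitone_sub (show (0 : unitInterval) ≤ p from p.2.1)
  simp only [bernoulliExp] at h1 h4
  have := p.2.1
  have := p.2.2
  nlinarith

theorem true_sub_le_two {l : unitInterval → Bool → ℝ} (hl : l ∈ LStar) (p : unitInterval) :
    l 0 true - l p true ≤ 2 := by
  have h2 := abs_le.1 (hl.2 0)
  have h3 := abs_le.1 (hl.2 p)
  have h4 := hl.1.monotone_false (show (0 : unitInterval) ≤ p from p.2.1)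
  simp only at h4
  linarith

/-- The part of `J` on which the outcome is `b`, as a measure on the predictions. -/
def outcomePart (J : Measure Sample) (b : Bool) : Measure unitInterval :=
  (J.restrict (Prod.snd ⁻¹' {b})).map Prod.fst

instance (J : Measure Sample) [IsFiniteMeasure J] (b : Bool) :
    IsFiniteMeasure (outcomePart J b) := by
  unfold outcomePart
  infer_instance

theorem outcomePart_real (J : Measure Sample) (b : Bool) {A : Set unitInterval}
    (hA : MeasurableSet A) : (outcomePart J b).real A = J.real (A ×ˢ {b}) := by
  unfold outcomePart
  rw [map_measureReal_apply measurable_fst hA, measureReal_restrict_apply (measurable_fst hA)]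
  rfl

theorem measureReal_outcomePart_add (J : Measure Sample) [IsProbabilityMeasure J] :
    (outcomePart J true).real univ + (outcomePart J false).real univ = 1 := by
  rw [outcomePart_real J _ MeasurableSet.univ, outcomePart_real J _ MeasurableSet.univ,
    ← measureReal_union, ← prod_union]
  · have : ({true} ∪ {false} : Set Bool) = univ := by ext b; cases b <;> simp
    rw [this, univ_prod_univ, probReal_univ]
  · rw [disjoint_left]
    rintro ⟨p, b⟩ h1 h2
    simp_all
  · exact MeasurableSet.univ.prod (measurableSet_singleton _)

theorem integral_eq_outcomeParts (J : Measure Sample) {f : Sample → ℝ} (hf : Integrable f J)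
    (hm : ∀ b, Measurable fun p => f (p, b)) :
    ∫ z, f z ∂J = (∫ p, f (p, true) ∂outcomePart J true)
      + ∫ p, f (p, false) ∂outcomePart J false := by
  have hs : MeasurableSet (Prod.snd ⁻¹' {true} : Set Sample) :=
    measurable_snd (measurableSet_singleton _)
  have hc : (Prod.snd ⁻¹' {true} : Set Sample)ᶜ = Prod.snd ⁻¹' {false} := by
    ext ⟨p, b⟩
    cases b <;> simp
  have key : ∀ b, ∫ p, f (p, b) ∂outcomePart J b = ∫ z in Prod.snd ⁻¹' {b}, f z ∂J := by
    intro b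
    unfold outcomePart
    rw [integral_map measurable_fst.aemeasurable (hm b).aestronglyMeasurable]
    refine setIntegral_congr_fun (measurable_snd (measurableSet_singleton _)) fun z hz => ?_
    simp only [mem_preimage, mem_singleton_iff] at hz
    simp only [← hz]
  rw [key, key, ← hc, integral_add_compl hs hf]

theorem integrable_loss {l : unitInterval → Bool → ℝ} (hl : l ∈ LStar)
    {k : unitInterval → unitInterval} (hk : Monotone k) (J : Measure Sample)
    [IsFiniteMeasure J] : Integrable (fun z : Sample => l (k z.1) z.2) J := by
  have hm : Measurable fun z : Sample => l (k z.1) z.2 := by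
    refine measurable_from_prod_countable_left fun b => ?_
    cases b
    · exact (hl.1.monotone_false.comp hk).measurable
    · exact (hl.1.antitone_true.comp_monotone hk).measurable
  refine Integrable.of_mem_Icc (min (l 0 false) (l 1 true)) (max (l 1 false) (l 0 true))
    hm.aemeasurable (Filter.Eventually.of_forall ?_)
  rintro ⟨p, b⟩
  have h0 : (0 : unitInterval) ≤ k p := (k p).2.1
  have h1 : k p ≤ 1 := (k p).2.2
  cases b
  · exact ⟨min_le_of_left_le (hl.1.monotone_false h0), le_max_of_le_left (hl.1.monotone_false h1)⟩
  · exact ⟨min_le_of_right_le (hl.1.antitone_true h1), le_max_of_le_right (hl.1.antitone_true h0)⟩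

/-- Subtracting the loss of the prediction 0 leaves two nonnegative nondecreasing functions of p,
the form required by `abs_integral_sub_le_of_monotone`. -/
theorem integral_loss_eq {l : unitInterval → Bool → ℝ} (hl : l ∈ LStar)
    {k : unitInterval → unitInterval} (hk : Monotone k) (J : Measure Sample)
    [IsProbabilityMeasure J] :
    ∫ z, l (k z.1) z.2 ∂J = l 0 false
      + (l 0 true - l 0 false) * (outcomePart J true).real univ
      - ∫ p, (l 0 true - l (k p) true) ∂outcomePart J true
      + ∫ p, (l (k p) false - l 0 false) ∂outcomePart J false := by
  have hf := hl.1.monotone_false.comp hk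
  have ht := hl.1.antitone_true.comp_monotone hk
  have ht' : Integrable (fun p => l (k p) true) (outcomePart J true) := by
    have := (integrable_of_monotone (outcomePart J true) ht.neg).neg
    simpa [Function.comp_def] using this
  have hf' : Integrable (fun p => l (k p) false) (outcomePart J false) :=
    integrable_of_monotone (outcomePart J false) hf
  rw [integral_eq_outcomeParts J (integrable_loss hl hk J)
    (fun b => by cases b; exacts [hf.measurable, ht.measurable]),
    integral_sub (integrable_const _) ht', integral_sub hf' (integrable_const _),
    integral_const, integral_const, smul_eq_mul, smul_eq_mul]
  have := measureReal_outcomePart_add J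
  have e : (outcomePart J false).real univ = 1 - (outcomePart J true).real univ := by linarith
  rw [e]
  ring

/-- The constant 5 is 1 + 2 + 2: the base term has a coefficient of absolute value at most 1, and
each outcome contributes a monotone function of range at most 2. -/
theorem abs_integral_loss_sub_le {l : unitInterval → Bool → ℝ} (hl : l ∈ LStar)
    {k : unitInterval → unitInterval} (hk : Monotone k) (J J' : Measure Sample)
    [IsProbabilityMeasure J] [IsProbabilityMeasure J'] {θ : ℝ}
    (h : ∀ b, ∀ A : Set unitInterval, IsUpperSet A →
      |(outcomePart J b).real A - (outcomePart J' b).real A| ≤ θ) :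
    |∫ z, l (k z.1) z.2 ∂J - ∫ z, l (k z.1) z.2 ∂J'| ≤ 5 * θ := by
  rw [integral_loss_eq hl hk J, integral_loss_eq hl hk J']
  have hf := hl.1.monotone_false.comp hk
  have ht := hl.1.antitone_true.comp_monotone hk
  have h1 := abs_integral_sub_le_of_monotone _ _ (h true) (K := 2)
    (g := fun p => l 0 true - l (k p) true) (fun p q hpq => sub_le_sub_left (ht hpq) _)
    (fun p => sub_nonneg.2 (hl.1.antitone_true (k p).2.1)) (fun p => true_sub_le_two hl _)
  have h2 := abs_integral_sub_le_of_monotone _ _ (h false) (K := 2)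
    (g := fun p => l (k p) false - l 0 false) (fun p q hpq => sub_le_sub_right (hf hpq) _)
    (fun p => sub_nonneg.2 (hl.1.monotone_false (k p).2.1)) (fun p => false_sub_le_two hl _)
  have h3 := h true univ isUpperSet_univ
  have h4 : |(l 0 true - l 0 false) * ((outcomePart J true).real univ
      - (outcomePart J' true).real univ)| ≤ θ := by
    rw [abs_mul]
    exact (mul_le_of_le_one_left (abs_nonneg _) (hl.2 0)).trans h3
  rw [abs_le] at *
  constructor <;> linarith

/-! ### The empirical measure -/

/-- The empirical distribution of a sample. -/
def empiricalMeasure {m : ℕ} (S : Fin m → Sample) : Measure Sample :=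
  (m : ENNReal)⁻¹ • ∑ i, Measure.dirac (S i)

theorem isProbabilityMeasure_empiricalMeasure {m : ℕ} (hm : 0 < m) (S : Fin m → Sample) :
    IsProbabilityMeasure (empiricalMeasure S) := by
  constructor
  simp only [empiricalMeasure, Measure.smul_apply, Measure.coe_finsetSum, Finset.sum_apply,
    measure_univ, Finset.sum_const, Finset.card_univ, Fintype.card_fin, smul_eq_mul, nsmul_eq_mul,
    mul_one]
  exact ENNReal.inv_mul_cancel (by exact_mod_cast hm.ne') (ENNReal.natCast_ne_top m)

theorem integral_empiricalMeasure {m : ℕ} (S : Fin m → Sample) (f : Sample → ℝ) :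
    ∫ z, f z ∂empiricalMeasure S = (m : ℝ)⁻¹ * ∑ i, f (S i) := by
  unfold empiricalMeasure
  rw [integral_smul_measure, integral_finsetSum_measure
    fun i _ => integrable_dirac (by simp)]
  simp

theorem empiricalMeasure_real {m : ℕ} (S : Fin m → Sample) {A : Set Sample}
    (hA : MeasurableSet A) :
    (empiricalMeasure S).real A = (m : ℝ)⁻¹ * ∑ i, A.indicator 1 (S i) := by
  rw [← integral_indicator_one hA, integral_empiricalMeasure]

theorem empiricalLoss_ofFn {m : ℕ} (hm : 0 < m) (S : Fin m → Sample)
    (l : unitInterval → Bool → ℝ) (k : unitInterval → unitInterval) :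
    empiricalLoss l (List.ofFn S) k = m * ∫ z, l (k z.1) z.2 ∂empiricalMeasure S := by
  have : (m : ℝ) ≠ 0 := by exact_mod_cast hm.ne'
  rw [integral_empiricalMeasure, mul_inv_cancel_left₀ this]
  simp [empiricalLoss, List.map_ofFn, List.sum_ofFn]

/-- Hoeffding's inequality: a variable in an interval of length 1 is sub-Gaussian with parameter 1/4
after centring. -/
theorem measure_sum_indicator_ge_le {m : ℕ} (hm : 0 < m) (J : Measure Sample)
    [IsProbabilityMeasure J] {f : Sample → ℝ} (hf : Measurable f) {a : ℝ}
    (hb : ∀ z, f z ∈ Icc a (a + 1)) {η : ℝ} (hη : 0 ≤ η) :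
    (Measure.pi fun _ : Fin m => J).real
      {S | m * η ≤ ∑ i, (f (S i) - ∫ z, f z ∂J)} ≤ Real.exp (-(2 * m * η ^ 2)) := by
  have hm' : (0 : ℝ) < m := by exact_mod_cast hm
  have hind : ProbabilityTheory.iIndepFun
      (fun (i : Fin m) (S : Fin m → Sample) => f (S i) - ∫ z, f z ∂J)
      (Measure.pi fun _ : Fin m => J) :=
    ProbabilityTheory.iIndepFun_pi (X := fun _ z => f z - ∫ z, f z ∂J)
      fun _ => (hf.sub_const _).aemeasurable
  have hsub : ∀ i : Fin m, ProbabilityTheory.HasSubgaussianMGF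
      (fun S : Fin m → Sample => f (S i) - ∫ z, f z ∂J) (1 / 4)
      (Measure.pi fun _ : Fin m => J) := by
    intro i
    have h := ProbabilityTheory.hasSubgaussianMGF_of_mem_Icc
      (μ := Measure.pi fun _ : Fin m => J) (X := fun S => f (S i)) (a := a) (b := a + 1)
      (hf.comp (measurable_pi_apply i)).aemeasurable
      (Filter.Eventually.of_forall fun S => hb (S i))
    have e : ∫ S : Fin m → Sample, f (S i) ∂(Measure.pi fun _ : Fin m => J) = ∫ z, f z ∂J := by
      rw [← integral_map (measurable_pi_apply i).aemeasurable hf.aestronglyMeasurable,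
        (measurePreserving_eval (fun _ : Fin m => J) i).map_eq]
    have e2 : ((‖a + 1 - a‖₊ / 2) ^ 2 : NNReal) = 1 / 4 := by
      rw [add_sub_cancel_left, nnnorm_one]
      norm_num
    rw [e, e2] at h
    exact h
  have := ProbabilityTheory.HasSubgaussianMGF.measure_sum_ge_le_of_iIndepFun hind
    (s := Finset.univ) (fun i _ => hsub i) (ε := m * η) (by positivity)
  refine this.trans (Real.exp_le_exp.2 (le_of_eq ?_))
  simp
  field_simp
  norm_num

/-! ### Uniform convergence and omniprediction -/

theorem measure_empiricalMeasure_ge_le {m : ℕ} (hm : 0 < m) (J : Measure Sample)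
    [IsProbabilityMeasure J] {B : Set Sample} (hB : MeasurableSet B) {η : ℝ} (hη : 0 ≤ η) :
    (Measure.pi fun _ : Fin m => J) {S | J.real B + η ≤ (empiricalMeasure S).real B}
      ≤ ENNReal.ofReal (Real.exp (-(2 * m * η ^ 2))) := by
  rw [← ofReal_measureReal]
  refine ENNReal.ofReal_le_ofReal ?_
  have h := measure_sum_indicator_ge_le hm J (f := B.indicator 1)
    (measurable_one.indicator hB) (a := 0) (fun z => ?_) hη
  · refine le_trans (measureReal_mono fun S hS => ?_) h
    have hm' : (0 : ℝ) < m := by exact_mod_cast hm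
    simp only [mem_ofPred_eq, empiricalMeasure_real S hB] at hS
    have h2 := mul_le_mul_of_nonneg_left hS hm'.le
    rw [mul_inv_cancel_left₀ hm'.ne'] at h2
    simp only [mem_ofPred_eq, Finset.sum_sub_distrib, Finset.sum_const, Finset.card_univ,
      Fintype.card_fin, nsmul_eq_mul, integral_indicator_one hB]
    linarith
  · by_cases hz : z ∈ B <;> simp [hz]

theorem measure_empiricalMeasure_le_le {m : ℕ} (hm : 0 < m) (J : Measure Sample)
    [IsProbabilityMeasure J] {B : Set Sample} (hB : MeasurableSet B) {η : ℝ} (hη : 0 ≤ η) :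
    (Measure.pi fun _ : Fin m => J) {S | (empiricalMeasure S).real B + η ≤ J.real B}
      ≤ ENNReal.ofReal (Real.exp (-(2 * m * η ^ 2))) := by
  rw [← ofReal_measureReal]
  refine ENNReal.ofReal_le_ofReal ?_
  have h := measure_sum_indicator_ge_le hm J (f := fun z => - B.indicator 1 z)
    (measurable_one.indicator hB).neg (a := -1) (fun z => ?_) hη
  · refine le_trans (measureReal_mono fun S hS => ?_) h
    have hm' : (0 : ℝ) < m := by exact_mod_cast hm
    simp only [mem_ofPred_eq, empiricalMeasure_real S hB] at hS
    have h2 := mul_le_mul_of_nonneg_left hS hm'.le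
    rw [mul_add, mul_inv_cancel_left₀ hm'.ne'] at h2
    simp only [mem_ofPred_eq, Finset.sum_sub_distrib, Finset.sum_const, Finset.card_univ,
      Fintype.card_fin, nsmul_eq_mul, integral_neg, integral_indicator_one hB,
      Finset.sum_neg_distrib]
    linarith
  · by_cases hz : z ∈ B <;> simp [hz]

/-- The brackets depend on J only, so they are fixed before sampling. It suffices that no upper
bracket is overrepresented and no lower bracket underrepresented by η: two events for each of 2(N +
2) indices. -/
theorem measure_not_uniform_le {m : ℕ} (hm : 0 < m) (J : Measure Sample)
    [IsProbabilityMeasure J] {N : ℕ} (hN : 0 < N) {η : ℝ} (hη : 0 ≤ η) :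
    (Measure.pi fun _ : Fin m => J) {S | ¬ ∀ b, ∀ A : Set unitInterval, IsUpperSet A →
      |(outcomePart J b).real A - (outcomePart (empiricalMeasure S) b).real A| ≤ 1 / N + η}
      ≤ ENNReal.ofReal (4 * (N + 2) * Real.exp (-(2 * m * η ^ 2))) := by
  have hle : ∀ b, (outcomePart J b).real univ ≤ 1 := by
    intro b
    rw [outcomePart_real J b MeasurableSet.univ]
    exact measureReal_le_one
  choose U L hU hL hUL hbr using fun b => exists_brackets (outcomePart J b) (hle b) hN
  set E : Bool × ℕ → Set (Fin m → Sample) := fun i =>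
    {S | J.real (U i.1 i.2 ×ˢ {i.1}) + η ≤ (empiricalMeasure S).real (U i.1 i.2 ×ˢ {i.1})} ∪
    {S | (empiricalMeasure S).real (L i.1 i.2 ×ˢ {i.1}) + η ≤ J.real (L i.1 i.2 ×ˢ {i.1})}
    with hE
  have hEle : ∀ i, (Measure.pi fun _ : Fin m => J) (E i)
      ≤ ENNReal.ofReal (2 * Real.exp (-(2 * m * η ^ 2))) := by
    intro i
    refine (measure_union_le _ _).trans ?_
    rw [two_mul, ENNReal.ofReal_add (Real.exp_pos _).le (Real.exp_pos _).le]
    exact add_le_add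
      (measure_empiricalMeasure_ge_le hm J ((hU _ _).prod (measurableSet_singleton _)) hη)
      (measure_empiricalMeasure_le_le hm J ((hL _ _).prod (measurableSet_singleton _)) hη)
  have hsub : {S | ¬ ∀ b, ∀ A : Set unitInterval, IsUpperSet A →
      |(outcomePart J b).real A - (outcomePart (empiricalMeasure S) b).real A| ≤ 1 / N + η}
      ⊆ ⋃ i ∈ (Finset.univ : Finset Bool) ×ˢ Finset.range (N + 2), E i := by
    intro S hS
    by_contra hcon
    refine hS fun b A hA => ?_
    have := isProbabilityMeasure_empiricalMeasure hm S
    obtain ⟨j, hj, hLA, hAU⟩ := hbr b A hA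
    have hnot : S ∉ E (b, j) := fun h => hcon (by
      simp only [mem_iUnion, Finset.mem_product, Finset.mem_univ, Finset.mem_range, true_and]
      exact ⟨(b, j), hj, h⟩)
    simp only [hE, mem_union, mem_ofPred_eq, not_or, not_le,
      ← outcomePart_real _ _ (hU b j), ← outcomePart_real _ _ (hL b j)] at hnot
    have h1 := measureReal_mono (μ := outcomePart J b) hLA
    have h2 := measureReal_mono (μ := outcomePart J b) hAU
    have h3 := measureReal_mono (μ := outcomePart (empiricalMeasure S) b) hLA
    have h4 := measureReal_mono (μ := outcomePart (empiricalMeasure S) b) hAU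
    have h5 := hUL b j hj
    rw [abs_le]
    constructor <;> linarith [hnot.1, hnot.2]
  refine (measure_mono hsub).trans ((measure_biUnion_finset_le _ _).trans ?_)
  refine (Finset.sum_le_sum fun i _ => hEle i).trans (le_of_eq ?_)
  rw [Finset.sum_const, Finset.card_product, Finset.card_univ, Fintype.card_bool,
    Finset.card_range, ← ENNReal.ofReal_nsmul]
  congr 1
  rw [nsmul_eq_mul]
  push_cast
  ring

/-- Empirical risk minimization: passing between J and the empirical distribution costs 5θ for the
fit and 5θ for the competitor, and in between the fit is empirically optimal. -/
theorem isOmnipredictor_of_uniform {m : ℕ} (hm : 0 < m) {J : Measure Sample}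
    [IsProbabilityMeasure J] {S : Fin m → Sample} {θ : ℝ}
    (h : ∀ b, ∀ A : Set unitInterval, IsUpperSet A →
      |(outcomePart J b).real A - (outcomePart (empiricalMeasure S) b).real A| ≤ θ)
    {O : List Sample} {T : List (unitInterval × unitInterval)}
    (hT : IsPAVOutput (List.ofFn S) O T) {ε : ℝ} (hε : 10 * θ ≤ ε) :
    IsOmnipredictor ε MPlus J (postProcessing O T) := by
  have := isProbabilityMeasure_empiricalMeasure hm S
  have hmono : Monotone (postProcessing O T) := hT.mem_MPlus
  refine ⟨hmono.measurable, fun l hl k hk => ?_⟩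
  have h1 := (abs_le.1 (abs_integral_loss_sub_le hl hmono J (empiricalMeasure S) h)).2
  have h2 := (abs_le.1 (abs_integral_loss_sub_le hl hk J (empiricalMeasure S) h)).1
  have h3 := hT.empiricalLoss_le hl.1 hk
  rw [empiricalLoss_ofFn hm, empiricalLoss_ofFn hm] at h3
  have h4 := le_of_mul_le_mul_left h3 (by exact_mod_cast hm)
  linarith

/-! ### Sample size and constants. -/

theorem log_two_div_pos {ε δ : ℝ} (hε : ε ∈ Ioo (0 : ℝ) 1) (hδ : δ ∈ Ioo (0 : ℝ) 1) :
    0.69 ≤ Real.log (2 / (ε * δ)) ∧ -Real.log ε ≤ Real.log (2 / (ε * δ)) := by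
  have h1 := Real.log_neg hε.1 hε.2
  have h2 := Real.log_neg hδ.1 hδ.2
  have h3 := Real.log_two_gt_d9
  rw [Real.log_div two_ne_zero (mul_pos hε.1 hδ.1).ne', Real.log_mul hε.1.ne' hδ.1.ne']
  constructor <;> linarith

theorem measure_not_isOmnipredictor_le {ε δ : ℝ} (hε : ε ∈ Ioo (0 : ℝ) 1)
    (hδ : δ ∈ Ioo (0 : ℝ) 1) {m : ℕ} (hm : 1400 * Real.log (2 / (ε * δ)) / ε ^ 2 ≤ (m : ℝ))
    (J : Measure Sample) [IsProbabilityMeasure J] :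
    (Measure.pi fun _ : Fin m => J)
      {S | ¬ ∀ (O : List Sample) (T : List (unitInterval × unitInterval)),
        IsPAVOutput (List.ofFn S) O T → IsOmnipredictor ε MPlus J (postProcessing O T)}
      ≤ ENNReal.ofReal δ := by
  obtain ⟨hε0, hε1⟩ := hε
  obtain ⟨hδ0, hδ1⟩ := hδ
  have hL := (log_two_div_pos ⟨hε0, hε1⟩ ⟨hδ0, hδ1⟩).1
  set L := Real.log (2 / (ε * δ)) with hLdef
  have hm0 : 0 < m := by
    have : 0 < 1400 * L / ε ^ 2 := by positivity
    exact_mod_cast this.trans_le hm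
  -- The error budget θ ≤ ε/10 is split equally: ε/20 for the brackets, ε/20 for Hoeffding
  -- deviations.
  set N := ⌈20 / ε⌉₊
  have hN1 : 20 / ε ≤ N := Nat.le_ceil _
  have hN2 : (N : ℝ) < 20 / ε + 1 := Nat.ceil_lt_add_one (by positivity)
  have hN : 0 < N := Nat.ceil_pos.2 (by positivity)
  have hN' : (0 : ℝ) < N := by exact_mod_cast hN
  have hinv : 1 / (N : ℝ) ≤ ε / 20 := by
    rw [div_le_div_iff₀ hN' (by norm_num)]
    rw [div_le_iff₀ hε0] at hN1
    linarith
  refine le_trans (measure_mono fun S hS => ?_) ((measure_not_uniform_le hm0 J hN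
    (η := ε / 20) (by positivity)).trans (ENNReal.ofReal_le_ofReal ?_))
  · intro h
    exact hS fun O T hT => isOmnipredictor_of_uniform hm0 h hT (by linarith)
  -- The constant 1400 is 7 · 200. Seven factors εδ/2 leave εδ/128, where ε cancels the 1/ε from the
  -- number of brackets and 128 beats 4 · 23.
  · have h1 : 7 * L ≤ 2 * m * (ε / 20) ^ 2 := by
      rw [div_le_iff₀ (by positivity)] at hm
      linarith
    have h2 : Real.exp (-(2 * m * (ε / 20) ^ 2)) ≤ (ε * δ / 2) ^ 7 := by
      refine (Real.exp_le_exp.2 (neg_le_neg h1)).trans (le_of_eq ?_)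
      have e : -(7 * L) = Real.log ((ε * δ / 2) ^ 7) := by
        rw [Real.log_pow, hLdef, ← inv_div, Real.log_inv]
        push_cast
        ring
      rw [e, Real.exp_log (by positivity)]
    have h3 : (N : ℝ) + 2 ≤ 23 / ε := by
      have : (3 : ℝ) ≤ 3 / ε := by
        rw [le_div_iff₀ hε0]
        linarith
      have : 23 / ε = 20 / ε + 3 / ε := by ring
      linarith
    have hx0 : 0 < ε * δ := by positivity
    have hx1 : ε * δ ≤ 1 := mul_le_one₀ hε1.le hδ0.le hδ1.le
    have h4 : (ε * δ / 2) ^ 7 ≤ ε * δ / 128 := by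
      have : (ε * δ) ^ 7 ≤ ε * δ := pow_le_of_le_one hx0.le hx1 (by norm_num)
      rw [div_pow]
      linarith
    calc 4 * ((N : ℝ) + 2) * Real.exp (-(2 * m * (ε / 20) ^ 2))
        ≤ 4 * (23 / ε) * (ε * δ / 128) := by
          refine mul_le_mul (by linarith) (h2.trans h4) (Real.exp_pos _).le (by positivity)
      _ = 92 / 128 * δ := by field_simp; norm_num
      _ ≤ δ := by linarith

/-- The constant is 60 · 2 · 1400 · 5000: running time, rounding up, sample size, and log m ≤ 5000 L
with L = log(2/(εδ)). -/
theorem pavT_time_le_of_length_eq {ε δ : ℝ} (hε : ε ∈ Ioo (0 : ℝ) 1) (hδ : δ ∈ Ioo (0 : ℝ) 1)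
    {S : List Sample} (hS : S.length = ⌈1400 * Real.log (2 / (ε * δ)) / ε ^ 2⌉₊) :
    ((pavT S).time : ℝ) ≤ 840000000 * Real.log (2 / (ε * δ)) ^ 2 / ε ^ 2 := by
  obtain ⟨hL, hLε⟩ := log_two_div_pos hε hδ
  set L := Real.log (2 / (ε * δ)) with hLdef
  obtain ⟨hε0, hε1⟩ := hε
  set x := 1400 * L / ε ^ 2 with hx
  have hx2 : 2 ≤ x := by
    rw [hx, le_div_iff₀ (by positivity)]
    have : ε ^ 2 ≤ 1 := pow_le_one₀ hε0.le hε1.le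
    linarith
  have hl1 : x ≤ S.length := by rw [hS]; exact Nat.le_ceil _
  have hl2 : (S.length : ℝ) ≤ 2 * x := by
    rw [hS]
    have := Nat.ceil_lt_add_one (show 0 ≤ x by linarith)
    linarith
  have hlen : 2 ≤ S.length := by
    have : (2 : ℝ) ≤ S.length := hx2.trans hl1
    exact_mod_cast this
  have hlog : Real.log S.length ≤ 5000 * L := by
    have h1 : Real.log S.length ≤ Real.log (2 * x) := Real.log_le_log (by linarith) hl2
    have e : 2 * x = 2800 * L / ε ^ 2 := by rw [hx]; ring
    rw [e, Real.log_div (by positivity) (by positivity),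
      Real.log_mul (by norm_num) (by linarith), Real.log_pow] at h1
    -- The crude bound log x ≤ x - 1 suffices, since L ≥ 0.69 absorbs the additive constant into
    -- 5000 L.
    have h2 := Real.log_le_sub_one_of_pos (show (0 : ℝ) < 2800 by norm_num)
    have h3 := Real.log_le_sub_one_of_pos (show 0 < L by linarith)
    push_cast at h1
    linarith
  have hlog0 : 0 ≤ Real.log S.length := Real.log_natCast_nonneg _
  calc ((pavT S).time : ℝ) ≤ 60 * ((S.length : ℝ) * Real.log S.length) :=
        pavT_time_le_log S hlen
    _ ≤ 60 * ((2 * x) * (5000 * L)) := by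
        refine mul_le_mul_of_nonneg_left (mul_le_mul hl2 hlog hlog0 (by linarith)) (by norm_num)
    _ = 840000000 * L ^ 2 / ε ^ 2 := by rw [hx]; ring

end PAV
end

theorem mainTheorem5 :
    -- every run on every finite sample gives a monotone post-processing that is optimal among the
    -- monotone ones, simultaneously for all proper losses
    (∀ (S O : List PAV.Sample) (T : List (unitInterval × unitInterval)),
      PAV.IsPAVOutput S O T →
        PAV.postProcessing O T ∈ PAV.MPlus ∧
        ∀ l : unitInterval → Bool → ℝ, PAV.IsProper l →
          IsLeast ((fun k => PAV.empiricalLoss l S k) '' PAV.MPlus)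
            (PAV.empiricalLoss l S (PAV.postProcessing O T))) ∧
    -- the implementation is correct and takes time O(m log m)
    (∀ S : List PAV.Sample,
      PAV.IsPAVOutput S (PAV.pavT S).val.1 ((PAV.pavT S).val.2.map PAV.Block.interval) ∧
      ∀ b ∈ (PAV.pavT S).val.2,
        b.mean = PAV.intervalMean (PAV.pavT S).val.1 b.interval) ∧
    (∃ C : ℝ, ∀ S : List PAV.Sample, 2 ≤ S.length →
      ((PAV.pavT S).time : ℝ) ≤ C * ((S.length : ℝ) * Real.log (S.length : ℝ))) ∧
    -- omniprediction from O(log(1/(εδ))/ε²) samples in time O(polylog(1/(εδ))/ε²)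
    (∃ C : ℝ, 0 < C ∧ ∃ (C' : ℝ) (r : ℕ), ∀ ε ∈ Set.Ioo (0 : ℝ) 1, ∀ δ ∈ Set.Ioo (0 : ℝ) 1,
      (∀ m : ℕ, C * Real.log (2 / (ε * δ)) / ε ^ 2 ≤ (m : ℝ) →
        ∀ (J : MeasureTheory.Measure PAV.Sample) [MeasureTheory.IsProbabilityMeasure J],
          (MeasureTheory.Measure.pi fun _ : Fin m => J)
            {S | ¬ ∀ (O : List PAV.Sample) (T : List (unitInterval × unitInterval)),
              PAV.IsPAVOutput (List.ofFn S) O T →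
                PAV.IsOmnipredictor ε PAV.MPlus J (PAV.postProcessing O T)}
            ≤ ENNReal.ofReal δ) ∧
      (∀ S : List PAV.Sample, S.length = ⌈C * Real.log (2 / (ε * δ)) / ε ^ 2⌉₊ →
        ((PAV.pavT S).time : ℝ) ≤ C' * Real.log (2 / (ε * δ)) ^ r / ε ^ 2)) := by
  exact ⟨fun S O T h => ⟨h.mem_MPlus, fun l hl => h.isLeast hl⟩, PAV.pavT_spec,
    ⟨60, PAV.pavT_time_le_log⟩,
    1400, by norm_num, 840000000, 2, fun ε hε δ hδ =>
      ⟨fun m hm J _ => PAV.measure_not_isOmnipredictor_le hε hδ hm J,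
        fun S hS => PAV.pavT_time_le_of_length_eq hε hδ hS⟩⟩
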